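/- Let $k$ be a positive integer and let $\Lambda$ be a finitely aligned $k$-graph, that is, a countable small category with a degree functor $d:\Lambda\to\mathbb{N}^k$ such that every $\lambda$ with $d(\lambda)=m+n$ factors uniquely as $\lambda=\mu\nu$ with $d(\mu)=m$, $d(\nu)=n$, and such that for all $\lambda,\mu\in\Lambda$ the set $\Lambda^{\min}(\lambda,\mu)=\{(\rho,\tau):\lambda\rho=\mu\tau,\ d(\lambda\rho)=d(\lambda)\vee d(\mu)\}$ is finite. Vertices are identified with identity morphisms. For a vertex $v$ let $v\Lambda$ be the set of paths with range $v$, and call a finite set $E\subseteq v\Lambda\setminus\{v\}$ exhaustive if for every $\lambda\in v\Lambda$ there is $\mu\in E$ with $\Lambda^{\min}(\lambda,\mu)\neq\emptyset$; write $r(E)=v$. Let $\mathrm{KP}_{\mathbb{C}}(\Lambda)$ be the universal (not necessarily unital) $\mathbb{C}$-algebra generated by elements $s_\lambda, s_{\mu^*}$ ($\lambda,\mu\in\Lambda$), with $s_{v^*}=s_v$ for vertices $v$, subject to: (KP1) the $s_v$ are mutually orthogonal idempotents; (KP2) $s_\lambda s_\mu=s_{\lambda\mu}$ and $s_{\mu^*}s_{\lambda^*}=s_{(\lambda\mu)^*}$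 whenever the source of $\lambda$ is the range of $\mu$; (KP3) $s_{\lambda^*}s_\mu=\sum_{(\rho,\tau)\in\Lambda^{\min}(\lambda,\mu)}s_\rho s_{\tau^*}$ for all $\lambda,\mu$; (KP4) $\prod_{\lambda\in E}(s_{r(E)}-s_\lambda s_{\lambda^*})=0$ for every finite exhaustive $E$. Let $C^*(\Lambda)$ be the universal $C^*$-algebra generated by a Cuntz–Krieger $\Lambda$-family $\{t_\lambda:\lambda\in\Lambda\}$, that is, partial isometries such that the $t_v$ are mutually orthogonal projections, $t_\lambda t_\mu=t_{\lambda\mu}$ for composable $\lambda,\mu$, $t_\lambda^*t_\mu=\sum_{(\rho,\tau)\in\Lambda^{\min}(\lambda,\mu)}t_\rho t_\tau^*$ for all $\lambda,\mu$, and $\prod_{\lambda\in E}(t_{r(E)}-t_\lambda t_\lambda^*)=0$ for every finite exhaustive $E$. Then $\operatorname{span}_{\mathbb{C}}\{t_\lambda t_\mu^*:\lambda,\mu\in\Lambda\}$ is a dense subalgebra of $C^*(\Lambda)$, and there is an isomorphism of $\mathbb{C}$-algebras $$\pi_t:\mathrm{KP}_{\mathbb{C}}(\Lambda)\to\operatorname{span}_{\mathbb{C}}\{t_\lambda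 t_\mu^*:\lambda,\mu\in\Lambda\}$$ such that $\pi_t(s_\lambda)=t_\lambda$ and $\pi_t(s_{\mu^*})=t_\mu^*$ for all $\lambda,\mu\in\Lambda$. In particular, $\mathrm{KP}_{\mathbb{C}}(\Lambda)$ is isomorphic to a dense subalgebra of $C^*(\Lambda)$. -/

import Mathlib

open scoped ENNReal

universe u w

/-- A higher-rank graph (`k`-graph): a countable small category, given by its vertices (objects) and
paths (morphisms), together with a degree functor to `ℕ^k` that has the unique factorisation
property. The composite `comp a b` is the path written `ab`; it is defined when the source of `a` is
the range of `b`. The vertex `v` is identified with the identity path `ident v`. -/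
structure HigherRankGraph (k : ℕ) where
  Vertex : Type u
  Path : Type u
  countable_path : Countable Path
  src : Path → Vertex
  rng : Path → Vertex
  ident : Vertex → Path
  comp : (a b : Path) → src a = rng b → Path
  src_ident : ∀ v, src (ident v) = v
  rng_ident : ∀ v, rng (ident v) = v
  src_comp : ∀ a b h, src (comp a b h) = src b
  rng_comp : ∀ a b h, rng (comp a b h) = rng a
  ident_comp : ∀ a, comp (ident (rng a)) a (src_ident _) = a
  comp_ident : ∀ a, comp a (ident (src a)) (rng_ident _).symm = a
  assoc : ∀ a b c (hab : src a = rng b) (hbc : src b = rng c),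
    comp (comp a b hab) c ((src_comp a b hab).trans hbc) =
      comp a (comp b c hbc) (hab.trans (rng_comp b c hbc).symm)
  deg : Path → (Fin k → ℕ)
  deg_ident : ∀ v, deg (ident v) = 0
  deg_comp : ∀ a b h, deg (comp a b h) = deg a + deg b
  factorisation : ∀ (a : Path) (m n : Fin k → ℕ), deg a = m + n →
    ∃! p : Path × Path, deg p.1 = m ∧ deg p.2 = n ∧ ∃ h, comp p.1 p.2 h = a

namespace HigherRankGraph

variable {k : ℕ} (L : HigherRankGraph.{u} k)

/-- `c` extends `a`, that is, `c(0, d(a)) = a`. -/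
def Extends (c a : L.Path) : Prop := ∃ b h, L.comp a b h = c

/-- The set `MCE(a, b)` of minimal common extensions. -/
def MCE (a b : L.Path) : Set L.Path :=
  {c | L.deg c = L.deg a ⊔ L.deg b ∧ L.Extends c a ∧ L.Extends c b}

/-- The set `Λ^min(a, b)` of pairs `(x, y)` with `ax = by ∈ MCE(a, b)`. -/
def minExt (a b : L.Path) : Set (L.Path × L.Path) :=
  {p | ∃ (ha : L.src a = L.rng p.1) (hb : L.src b = L.rng p.2),
    L.comp a p.1 ha = L.comp b p.2 hb ∧ L.comp a p.1 ha ∈ L.MCE a b}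

/-- `Λ` is finitely aligned. -/
def FinitelyAligned : Prop := ∀ a b : L.Path, (L.minExt a b).Finite

/-- A set `E` of paths with range `v` is exhaustive. -/
def Exhaustive (v : L.Vertex) (E : Set L.Path) : Prop :=
  ∀ a, L.rng a = v → ∃ b ∈ E, (L.minExt a b).Nonempty

/-- The finite exhaustive subsets of `vΛ \ {v}`; the set `FE(Λ)` is the union of these over `v`. -/
def FE (v : L.Vertex) : Set (Finset L.Path) :=
  {E | (∀ a ∈ E, L.rng a = v ∧ a ≠ L.ident v) ∧ L.Exhaustive v E}

/-- For a list `a₁, …, aₙ` of paths, the product `(S_v - S_{a₁} S_{a₁*}) ⋯ (S_v - S_{aₙ} S_{aₙ*}) S_v`.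
If all `aᵢ` have range `v` then the last factor `S_v` is absorbed in the families considered below:
it only serves as the empty product, as the algebras have no unit in general. -/
def gapProd {L : HigherRankGraph.{u} k} {A : Type*} [NonUnitalRing A] (S S' : L.Path → A)
    (v : L.Vertex) : List L.Path → A
  | [] => S (L.ident v)
  | a :: l => (S (L.ident v) - S a * S' a) * gapProd S S' v l

/-- `S`, `S'` (with `S' a` standing for `S_{a*}`) form a Kumjian-Pask `Λ`-family in `A`. In `kp4` the
product over the finite exhaustive set `E` is taken along each enumeration of `E` (its factors
commute, by the other relations). -/
structure IsKumjianPaskFamily {A : Type*} [NonUnitalRing A] (S S' : L.Path → A) : Prop where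
  ghost_ident : ∀ v, S' (L.ident v) = S (L.ident v)
  kp1_idem : ∀ v, S (L.ident v) * S (L.ident v) = S (L.ident v)
  kp1_orth : ∀ v v', v ≠ v' → S (L.ident v) * S (L.ident v') = 0
  kp2_path : ∀ a b h, S a * S b = S (L.comp a b h)
  kp2_ghost : ∀ a b h, S' b * S' a = S' (L.comp a b h)
  kp3 : ∀ a b, S' a * S b = ∑ᶠ p ∈ L.minExt a b, S p.1 * S' p.2
  kp4 : ∀ v, ∀ E ∈ L.FE v, ∀ l : List L.Path, (l : Multiset L.Path) = E.val → gapProd S S' v l = 0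

/-- A Cuntz-Krieger `Λ`-family in a C*-algebra. -/
structure IsCuntzKriegerFamily {B : Type*} [NonUnitalCStarAlgebra B] (T : L.Path → B) : Prop where
  partial_isometry : ∀ a, T a = T a * star (T a) * T a
  tck1_proj : ∀ v, IsStarProjection (T (L.ident v))
  tck1_orth : ∀ v v', v ≠ v' → T (L.ident v) * T (L.ident v') = 0
  tck2 : ∀ a b h, T a * T b = T (L.comp a b h)
  tck3 : ∀ a b, star (T a) * T b = ∑ᶠ p ∈ L.minExt a b, T p.1 * star (T p.2)
  ck : ∀ v, ∀ E ∈ L.FE v, ∀ l : List L.Path, (l : Multiset L.Path) = E.val →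
    gapProd T (fun a => star (T a)) v l = 0

/-! ### The Kumjian-Pask algebra -/

/-- The ideal of a non-unital `R`-algebra generated by a set. -/
def idealGen (R : Type*) [CommRing R] {F : Type*} [NonUnitalRing F] [Module R F] (X : Set F) :
    Submodule R F :=
  sInf {I | X ⊆ I ∧ ∀ x ∈ I, ∀ a, a * x ∈ I ∧ x * a ∈ I}

section idealGen

variable {R : Type*} [CommRing R] {F : Type*} [NonUnitalRing F] [Module R F] {X : Set F}

theorem subset_idealGen : X ⊆ idealGen R X := fun _ hx =>
  Submodule.mem_sInf.2 fun _ hI => hI.1 hx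

theorem idealGen_mul_left (a : F) {x : F} (hx : x ∈ idealGen R X) : a * x ∈ idealGen R X :=
  Submodule.mem_sInf.2 fun _ hI => (hI.2 x (Submodule.mem_sInf.1 hx _ hI) a).1

theorem idealGen_mul_right (a : F) {x : F} (hx : x ∈ idealGen R X) : x * a ∈ idealGen R X :=
  Submodule.mem_sInf.2 fun _ hI => (hI.2 x (Submodule.mem_sInf.1 hx _ hI) a).2

theorem idealGen_le {I : Submodule R F} (hX : X ⊆ I)
    (hI : ∀ x ∈ I, ∀ a, a * x ∈ I ∧ x * a ∈ I) : idealGen R X ≤ I :=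
  sInf_le ⟨hX, hI⟩

end idealGen

/-- The letters: paths `a` and ghost paths `a*`. -/
inductive Letter (P : Type u) : Type u
  | path (a : P) : Letter P
  | ghost (a : P) : Letter P

/-- The free (non-unital) `R`-algebra on the paths and ghost paths, with basis the non-empty words. -/
abbrev FreeAlg (R : Type w) [CommRing R] : Type max u w :=
  MonoidAlgebra R (FreeSemigroup (Letter L.Path))

/-- The word of length one `a`. -/
noncomputable def freePath (R : Type w) [CommRing R] (a : L.Path) : L.FreeAlg R :=
  MonoidAlgebra.single (FreeSemigroup.of (Letter.path a)) 1

/-- The word of length one `a*`. -/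
noncomputable def freeGhost (R : Type w) [CommRing R] (a : L.Path) : L.FreeAlg R :=
  MonoidAlgebra.single (FreeSemigroup.of (Letter.ghost a)) 1

/-- The relators of the Kumjian-Pask algebra. -/
inductive KPRelator (R : Type w) [CommRing R] : L.FreeAlg R → Prop
  | ghost_ident (v : L.Vertex) :
      KPRelator R (L.freeGhost R (L.ident v) - L.freePath R (L.ident v))
  | idem (v : L.Vertex) :
      KPRelator R (L.freePath R (L.ident v) * L.freePath R (L.ident v) - L.freePath R (L.ident v))
  | orth (v v' : L.Vertex) (h : v ≠ v') :
      KPRelator R (L.freePath R (L.ident v) * L.freePath R (L.ident v'))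
  | comp_path (a b : L.Path) (h : L.src a = L.rng b) :
      KPRelator R (L.freePath R a * L.freePath R b - L.freePath R (L.comp a b h))
  | comp_ghost (a b : L.Path) (h : L.src a = L.rng b) :
      KPRelator R (L.freeGhost R b * L.freeGhost R a - L.freeGhost R (L.comp a b h))
  | ghost_path (a b : L.Path) :
      KPRelator R (L.freeGhost R a * L.freePath R b -
        ∑ᶠ p ∈ L.minExt a b, L.freePath R p.1 * L.freeGhost R p.2)
  | gap (v : L.Vertex) (E : Finset L.Path) (hE : E ∈ L.FE v) (l : List L.Path)
      (hl : (l : Multiset L.Path) = E.val) :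
      KPRelator R (gapProd (L.freePath R) (L.freeGhost R) v l)

/-- The ideal of the free algebra generated by the Kumjian-Pask relators. -/
noncomputable def kpIdeal (R : Type w) [CommRing R] : Submodule R (L.FreeAlg R) :=
  idealGen R {x | L.KPRelator R x}

/-- The Kumjian-Pask algebra `KP_R(Λ)`. -/
def KP (R : Type w) [CommRing R] : Type max u w := L.FreeAlg R ⧸ L.kpIdeal R

namespace KP

variable {L} {R : Type w} [CommRing R]

noncomputable instance : AddCommGroup (L.KP R) :=
  inferInstanceAs (AddCommGroup (L.FreeAlg R ⧸ L.kpIdeal R))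

noncomputable instance : Module R (L.KP R) :=
  inferInstanceAs (Module R (L.FreeAlg R ⧸ L.kpIdeal R))

variable (L R) in
/-- The quotient map. -/
noncomputable def mkLinear : L.FreeAlg R →ₗ[R] L.KP R := (L.kpIdeal R).mkQ

theorem mkLinear_surjective : Function.Surjective (mkLinear L R) := Submodule.mkQ_surjective _

theorem mkLinear_eq_iff {x y : L.FreeAlg R} :
    mkLinear L R x = mkLinear L R y ↔ x - y ∈ L.kpIdeal R := Submodule.Quotient.eq _

noncomputable instance : Mul (L.KP R) where
  mul x y := Quotient.liftOn₂' x y (fun a b => mkLinear L R (a * b)) fun a₁ b₁ a₂ b₂ ha hb => by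
    rw [Submodule.quotientRel_def] at ha hb
    rw [mkLinear_eq_iff]
    have h : a₁ * b₁ - a₂ * b₂ = (a₁ - a₂) * b₁ + a₂ * (b₁ - b₂) := by
      rw [sub_mul, mul_sub]; abel
    rw [h]
    exact add_mem (idealGen_mul_right _ ha) (idealGen_mul_left _ hb)

theorem mkLinear_mul (x y : L.FreeAlg R) :
    mkLinear L R (x * y) = mkLinear L R x * mkLinear L R y := rfl

noncomputable instance : NonUnitalRing (L.KP R) where
  left_distrib x y z := by
    obtain ⟨x, rfl⟩ := mkLinear_surjective x
    obtain ⟨y, rfl⟩ := mkLinear_surjective y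
    obtain ⟨z, rfl⟩ := mkLinear_surjective z
    simp only [← map_add, ← mkLinear_mul, mul_add]
  right_distrib x y z := by
    obtain ⟨x, rfl⟩ := mkLinear_surjective x
    obtain ⟨y, rfl⟩ := mkLinear_surjective y
    obtain ⟨z, rfl⟩ := mkLinear_surjective z
    simp only [← map_add, ← mkLinear_mul, add_mul]
  zero_mul x := by
    obtain ⟨x, rfl⟩ := mkLinear_surjective x
    rw [← map_zero (mkLinear L R), ← mkLinear_mul, zero_mul]
  mul_zero x := by
    obtain ⟨x, rfl⟩ := mkLinear_surjective x
    rw [← map_zero (mkLinear L R), ← mkLinear_mul, mul_zero]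
  mul_assoc x y z := by
    obtain ⟨x, rfl⟩ := mkLinear_surjective x
    obtain ⟨y, rfl⟩ := mkLinear_surjective y
    obtain ⟨z, rfl⟩ := mkLinear_surjective z
    simp only [← mkLinear_mul, mul_assoc]

instance : IsScalarTower R (L.KP R) (L.KP R) where
  smul_assoc r x y := by
    obtain ⟨x, rfl⟩ := mkLinear_surjective x
    obtain ⟨y, rfl⟩ := mkLinear_surjective y
    simp only [smul_eq_mul, ← map_smul, ← mkLinear_mul, smul_mul_assoc]

instance : SMulCommClass R (L.KP R) (L.KP R) where
  smul_comm r x y := by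
    obtain ⟨x, rfl⟩ := mkLinear_surjective x
    obtain ⟨y, rfl⟩ := mkLinear_surjective y
    simp only [smul_eq_mul, ← map_smul, ← mkLinear_mul, mul_smul_comm]

variable (L R) in
/-- The quotient map, as a homomorphism of algebras. -/
noncomputable def mk : L.FreeAlg R →ₙₐ[R] L.KP R where
  toFun := mkLinear L R
  map_smul' := map_smul (mkLinear L R)
  map_zero' := map_zero (mkLinear L R)
  map_add' := map_add (mkLinear L R)
  map_mul' := mkLinear_mul

variable (L R) in
/-- The generator `s_a`. -/
noncomputable def s (a : L.Path) : L.KP R := mk L R (L.freePath R a)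

variable (L R) in
/-- The generator `s_{a*}`. -/
noncomputable def sGhost (a : L.Path) : L.KP R := mk L R (L.freeGhost R a)

end KP

/-- Algebra homomorphisms preserve `gapProd`. -/
theorem map_gapProd {L : HigherRankGraph.{u} k} {R A B : Type*} [CommRing R]
    [NonUnitalRing A] [Module R A] [NonUnitalRing B] [Module R B] (f : A →ₙₐ[R] B)
    (S S' : L.Path → A) (v : L.Vertex) (l : List L.Path) :
    f (gapProd S S' v l) = gapProd (fun a => f (S a)) (fun a => f (S' a)) v l := by
  induction l with
  | nil => rfl
  | cons a l ih => simp only [gapProd, map_mul, map_sub, ih]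

/-- Algebra homomorphisms preserve the sums in the third Kumjian-Pask relation. -/
theorem map_minExt_sum {L : HigherRankGraph.{u} k} (hL : L.FinitelyAligned) {R A B : Type*}
    [CommRing R] [NonUnitalRing A] [Module R A] [NonUnitalRing B] [Module R B] (f : A →ₙₐ[R] B)
    (S S' : L.Path → A) (a b : L.Path) :
    f (∑ᶠ p ∈ L.minExt a b, S p.1 * S' p.2) = ∑ᶠ p ∈ L.minExt a b, f (S p.1) * f (S' p.2) := by
  have h := AddMonoidHom.map_finsum_mem (fun p : L.Path × L.Path => S p.1 * S' p.2)
    (f : A →+ B) (hL a b)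
  refine h.trans ?_
  simp

/-- The generators of `KP_R(Λ)` form a Kumjian-Pask `Λ`-family. -/
theorem KP.isKumjianPaskFamily {L : HigherRankGraph.{u} k} (hL : L.FinitelyAligned)
    (R : Type w) [CommRing R] : L.IsKumjianPaskFamily (KP.s L R) (KP.sGhost L R) := by
  have key : ∀ x, L.KPRelator R x → KP.mk L R x = 0 := fun x hx =>
    (Submodule.Quotient.mk_eq_zero _).2 (subset_idealGen hx)
  constructor
  · intro v
    simpa [sub_eq_zero, KP.s, KP.sGhost] using key _ (.ghost_ident v)
  · intro v
    simpa [sub_eq_zero, KP.s, KP.sGhost] using key _ (.idem v)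
  · intro v v' h
    simpa [sub_eq_zero, KP.s, KP.sGhost] using key _ (.orth v v' h)
  · intro a b h
    simpa [sub_eq_zero, KP.s, KP.sGhost] using key _ (.comp_path a b h)
  · intro a b h
    simpa [sub_eq_zero, KP.s, KP.sGhost] using key _ (.comp_ghost a b h)
  · intro a b
    have h := key _ (.ghost_path a b)
    rw [map_sub, sub_eq_zero, map_mul, map_minExt_sum hL] at h
    exact h
  · intro v E hE l hl
    have h := key _ (.gap v E hE l hl)
    rwa [map_gapProd] at h

/-- The universal property of `KP_R(Λ)`. -/
theorem KP.existsUnique_hom {L : HigherRankGraph.{u} k} (hL : L.FinitelyAligned)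
    {R : Type w} [CommRing R] {A : Type*} [NonUnitalRing A] [Module R A] [IsScalarTower R A A]
    [SMulCommClass R A A] {S S' : L.Path → A} (h : L.IsKumjianPaskFamily S S') :
    ∃! f : L.KP R →ₙₐ[R] A, ∀ a, f (KP.s L R a) = S a ∧ f (KP.sGhost L R a) = S' a := by
  let g : Letter L.Path → A := fun x => match x with
    | .path a => S a
    | .ghost a => S' a
  let φ : L.FreeAlg R →ₙₐ[R] A := MonoidAlgebra.liftMagma R (FreeSemigroup.lift g)
  have hp : ∀ a, φ (L.freePath R a) = S a := fun a => by
    simp [φ, freePath, g]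
  have hg : ∀ a, φ (L.freeGhost R a) = S' a := fun a => by
    simp [φ, freeGhost, g]
  have hker : L.kpIdeal R ≤ LinearMap.ker (φ : L.FreeAlg R →ₗ[R] A) := by
    refine idealGen_le ?_ ?_
    · intro x hx
      change φ x = 0
      cases hx with
      | ghost_ident v => simp [hp, hg, h.ghost_ident]
      | idem v => simp [hp, h.kp1_idem]
      | orth v v' hv => simp [hp, h.kp1_orth v v' hv]
      | comp_path a b hab => simp [hp, h.kp2_path a b hab]
      | comp_ghost a b hab => simp [hg, h.kp2_ghost a b hab]
      | ghost_path a b =>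
        rw [map_sub, map_mul, map_minExt_sum hL]
        simp only [hp, hg, h.kp3 a b, sub_self]
      | gap v E hE l hl =>
        rw [map_gapProd]
        simp only [hp, hg]
        exact h.kp4 v E hE l hl
    · intro x hx a
      have hx' : φ x = 0 := hx
      constructor
      · change φ (a * x) = 0
        rw [map_mul, hx', mul_zero]
      · change φ (x * a) = 0
        rw [map_mul, hx', zero_mul]
  let ψ : L.KP R →ₗ[R] A := (L.kpIdeal R).liftQ (φ : L.FreeAlg R →ₗ[R] A) hker
  have hψ : ∀ x, ψ (KP.mkLinear L R x) = φ x := fun x => rfl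
  refine ⟨{ toFun := ψ, map_smul' := map_smul ψ, map_zero' := map_zero ψ, map_add' := map_add ψ
            map_mul' := ?_ }, ?_, ?_⟩
  · intro x y
    obtain ⟨x, rfl⟩ := KP.mkLinear_surjective x
    obtain ⟨y, rfl⟩ := KP.mkLinear_surjective y
    rw [← KP.mkLinear_mul, hψ, hψ, hψ, map_mul]
  · intro a
    exact ⟨hp a, hg a⟩
  · intro f hf
    have hfφ : f.comp (KP.mk L R) = φ := by
      apply (MonoidAlgebra.liftMagma R).symm.injective
      apply FreeSemigroup.hom_ext
      funext x
      cases x with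
      | path a => exact ((hf a).1).trans (hp a).symm
      | ghost a => exact ((hf a).2).trans (hg a).symm
    ext x
    obtain ⟨x, rfl⟩ := KP.mkLinear_surjective x
    exact DFunLike.congr_fun hfφ x

/-! ### The C*-algebra of a higher-rank graph -/

/-- A representation of `Λ`: a C*-algebra with a Cuntz-Krieger `Λ`-family in it. -/
structure CKRep : Type (u + 1) where
  B : Type u
  [cstar : NonUnitalCStarAlgebra B]
  T : L.Path → B
  isCK : L.IsCuntzKriegerFamily T

attribute [instance] CKRep.cstar

variable {L}

/-- The members of a Cuntz-Krieger family have norm at most one. -/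
theorem IsCuntzKriegerFamily.norm_le_one {B : Type*} [NonUnitalCStarAlgebra B] {T : L.Path → B}
    (h : L.IsCuntzKriegerFamily T) (a : L.Path) : ‖T a‖ ≤ 1 := by
  set p := star (T a) * T a with hp
  have hpp : star p * p = p := by
    have h1 : star p = p := by simp [hp]
    rw [h1]
    conv_rhs => rw [hp, h.partial_isometry a]
    rw [hp]
    conv_rhs => rw [← h.partial_isometry a]
    conv_rhs => rw [h.partial_isometry a]
    simp only [star_mul, star_star, mul_assoc]
    simp only [← mul_assoc, ← h.partial_isometry a]
  have h2 : ‖p‖ = ‖p‖ * ‖p‖ := by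
    conv_lhs => rw [← hpp, CStarRing.norm_star_mul_self]
  have h3 : ‖p‖ = ‖T a‖ * ‖T a‖ := CStarRing.norm_star_mul_self
  rcases (norm_nonneg p).eq_or_lt with h4 | h4
  · nlinarith [norm_nonneg (T a)]
  · have h5 : ‖p‖ = 1 := by
      have h6 : ‖p‖ * 1 = ‖p‖ * ‖p‖ := by rw [mul_one]; exact h2
      exact (mul_left_cancel₀ h4.ne' h6).symm
    nlinarith [norm_nonneg (T a)]

variable (L)

/-- The C*-algebra of bounded families indexed by all representations of `Λ`. -/
abbrev CKProduct : Type (u + 1) := lp (fun i : L.CKRep => i.B) ∞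

/-- The family `a ↦ (T_a)` over all representations `(B, T)` of `Λ`. -/
noncomputable def tProd (a : L.Path) : L.CKProduct :=
  ⟨fun i => i.T a, memℓp_infty ⟨1, by rintro _ ⟨i, rfl⟩; exact i.isCK.norm_le_one a⟩⟩

/-- The closed `*`-subalgebra generated by the `tProd a`. -/
noncomputable def cstarSubalgebra : NonUnitalStarSubalgebra ℂ L.CKProduct :=
  (NonUnitalStarAlgebra.adjoin ℂ (Set.range L.tProd)).topologicalClosure

/-- The C*-algebra `C*(Λ)`: the universal C*-algebra generated by a Cuntz-Krieger `Λ`-family,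
realised inside the product of all representations. Restricting to C*-algebras in `Type u` loses
nothing, since a C*-algebra generated by a countable family has at most continuum many elements. -/
def CStar : Type (u + 1) := L.cstarSubalgebra

noncomputable instance : NonUnitalCStarAlgebra L.CStar :=
  NonUnitalStarSubalgebra.nonUnitalCStarAlgebra L.cstarSubalgebra
    (h_closed := NonUnitalStarSubalgebra.isClosed_topologicalClosure _)

/-- The generator `t_a` of `C*(Λ)`. -/
noncomputable def t (a : L.Path) : L.CStar :=
  ⟨L.tProd a, NonUnitalStarSubalgebra.le_topologicalClosure _
    (NonUnitalStarAlgebra.subset_adjoin ℂ _ ⟨a, rfl⟩)⟩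

variable {L}

/-- The coordinates of `C*(Λ)` in the product of all representations. -/
noncomputable def CStar.eval (i : L.CKRep) : L.CStar →⋆ₙₐ[ℂ] i.B where
  toFun x := x.1 i
  map_smul' _ _ := rfl
  map_zero' := rfl
  map_add' _ _ := rfl
  map_mul' _ _ := rfl
  map_star' _ := rfl

theorem CStar.eval_t (i : L.CKRep) (a : L.Path) : CStar.eval i (L.t a) = i.T a := rfl

theorem CStar.ext_eval {x y : L.CStar} (h : ∀ i, CStar.eval i x = CStar.eval i y) : x = y :=
  Subtype.ext (Subtype.ext (funext h))

/-- The generators of `C*(Λ)` form a Cuntz-Krieger `Λ`-family. -/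
theorem t_isCuntzKriegerFamily (hL : L.FinitelyAligned) : L.IsCuntzKriegerFamily L.t := by
  constructor
  · intro a
    refine CStar.ext_eval fun i => ?_
    exact i.isCK.partial_isometry a
  · intro v
    refine ⟨CStar.ext_eval fun i => ?_, CStar.ext_eval fun i => ?_⟩
    · exact (i.isCK.tck1_proj v).isIdempotentElem.eq
    · exact (i.isCK.tck1_proj v).isSelfAdjoint.star_eq
  · intro v v' h
    refine CStar.ext_eval fun i => ?_
    exact i.isCK.tck1_orth v v' h
  · intro a b h
    refine CStar.ext_eval fun i => ?_
    exact i.isCK.tck2 a b h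
  · intro a b
    refine CStar.ext_eval fun i => ?_
    have h := map_minExt_sum hL (CStar.eval i : L.CStar →ₙₐ[ℂ] i.B) L.t (fun c => star (L.t c)) a b
    refine Eq.trans ?_ h.symm
    exact i.isCK.tck3 a b
  · intro v E hE l hl
    refine CStar.ext_eval fun i => ?_
    have h := map_gapProd (CStar.eval i : L.CStar →ₙₐ[ℂ] i.B) L.t (fun c => star (L.t c)) v l
    refine h.trans ?_
    exact i.isCK.ck v E hE l hl

/-- The generators generate `C*(Λ)` as a C*-algebra. -/
theorem CStar.dense_adjoin :
    Dense (NonUnitalStarAlgebra.adjoin ℂ (Set.range L.t) : Set L.CStar) := by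
  let ι : L.CStar →⋆ₙₐ[ℂ] L.CKProduct := NonUnitalStarSubalgebraClass.subtype L.cstarSubalgebra
  have himg : (ι '' (NonUnitalStarAlgebra.adjoin ℂ (Set.range L.t) : Set L.CStar)) =
      (NonUnitalStarAlgebra.adjoin ℂ (Set.range L.tProd) : Set L.CKProduct) := by
    have h := NonUnitalStarAlgHom.map_adjoin ι (Set.range L.t)
    have h2 : ι '' Set.range L.t = Set.range L.tProd := by
      rw [← Set.range_comp]; rfl
    rw [h2] at h
    rw [← h]
    rfl
  intro x
  have hx : (x.1 : L.CKProduct) ∈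
      closure (NonUnitalStarAlgebra.adjoin ℂ (Set.range L.tProd) : Set L.CKProduct) := x.2
  rw [← himg] at hx
  exact closure_subtype.2 hx

/-- The universal property of `C*(Λ)`. -/
theorem CStar.existsUnique_hom {B : Type u} [NonUnitalCStarAlgebra B] {T : L.Path → B}
    (h : L.IsCuntzKriegerFamily T) : ∃! f : L.CStar →⋆ₙₐ[ℂ] B, ∀ a, f (L.t a) = T a := by
  refine ⟨CStar.eval ⟨B, T, h⟩, fun a => rfl, fun f hf => ?_⟩
  have hc (g : L.CStar →⋆ₙₐ[ℂ] B) : Continuous g :=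
    (NonUnitalStarAlgHom.instContinuousLinearMapClassComplex (F := L.CStar →⋆ₙₐ[ℂ] B)).map_continuous g
  refine DFunLike.coe_injective ((hc f).ext_on CStar.dense_adjoin (hc (CStar.eval ⟨B, T, h⟩)) fun x hx => ?_)
  induction hx using NonUnitalStarAlgebra.adjoin_induction with
  | mem x hx =>
    obtain ⟨a, rfl⟩ := hx
    exact hf a
  | add x y _ _ hx hy => simp only [map_add, hx, hy]
  | zero => simp only [map_zero]
  | mul x y _ _ hx hy => simp only [map_mul, hx, hy]
  | smul r x _ hx => simp only [map_smul, hx]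
  | star x _ hx => simp only [map_star, hx]

end HigherRankGraph

namespace HigherRankGraph

variable {k : ℕ} {L : HigherRankGraph.{u} k}

/-! ### Factorisations of paths -/

/-! The generators `t_a`, `t_a*` satisfy the Kumjian-Pask relations, so the universal property gives
a homomorphism from `KP` to `C*(Λ)`. The `s_a s_b*` span `KP` (`KP.span_eq_top`), so its range is
the span in the theorem; this is closed under `star` and hence contains the dense `*`-algebra
generated by the `t_a`. What remains is injectivity, for which it is enough that one Cuntz-Krieger
family separates the elements of `KP`.

The algebraic half is `exists_combination`. Write q_a for S_a S_{a*}. These idempotents commute, and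
products of gaps 1 - q_a are handled as operators (`gapAct`), since there is no unit. Given x ≠ 0,
cut it down on the right (`exists_cut`) so that each ghost b* in x is either annihilated or absorbed
into a longer path. This leaves y g ≠ 0, with y a combination of paths of one source and g a gap
product. Since g ≠ 0, (KP4) forbids the paths in g from being exhaustive, so some path e has no
common extension with any of them, and g S_e = S_e. Hence a right multiple of x has the form y S_e
with y a non-zero combination of paths.

The analytic half is a representation on `ℓ²` of a boundary whose points are ultrafilters of paths
that contain every dense open set, paired with a label in ℤ^k. Ultrafilters make finite unions
split, which gives (KP3); genericity makes finite exhaustive sets cover, which gives (KP4). The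
label records degrees, so for every boundary point z that starts at the source of e, the points c e
z are distinct for distinct paths c of the given source, even when the graph is periodic. Applying y
S_e to the point mass at such a z therefore reads off the coefficients of y
(`eq_zero_of_sum_bdryOp`), so x cannot be in the kernel. -/

theorem comp_eq_comp {a b a' b' : L.Path} {h : L.src a = L.rng b} {h' : L.src a' = L.rng b'}
    (hc : L.comp a b h = L.comp a' b' h') (hd : L.deg a = L.deg a') : a = a' ∧ b = b' := by
  have hd2 : L.deg b = L.deg b' := by
    have := congrArg L.deg hc
    rw [L.deg_comp, L.deg_comp, hd] at this
    exact add_left_cancel this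
  have := (L.factorisation (L.comp a b h) _ _ (L.deg_comp a b h)).unique
    (y₁ := (a, b)) (y₂ := (a', b')) ⟨rfl, rfl, h, rfl⟩ ⟨hd.symm, hd2.symm, h', hc.symm⟩
  exact ⟨congrArg Prod.fst this, congrArg Prod.snd this⟩

theorem comp_left_cancel {a b c : L.Path} {h : L.src a = L.rng b} {h' : L.src a = L.rng c}
    (hc : L.comp a b h = L.comp a c h') : b = c :=
  (comp_eq_comp hc rfl).2

theorem Extends.refl (a : L.Path) : L.Extends a a := ⟨_, _, L.comp_ident a⟩

theorem extends_comp (a b : L.Path) (h : L.src a = L.rng b) : L.Extends (L.comp a b h) a :=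
  ⟨b, h, rfl⟩

theorem Extends.trans {a b c : L.Path} (hcb : L.Extends c b) (hba : L.Extends b a) :
    L.Extends c a := by
  obtain ⟨x, hx, rfl⟩ := hba
  obtain ⟨y, hy, rfl⟩ := hcb
  have hy' : L.src x = L.rng y := by rw [← hy, L.src_comp]
  exact ⟨L.comp x y hy', _, (L.assoc a x y hx hy').symm⟩

theorem Extends.rng_eq {a c : L.Path} (h : L.Extends c a) : L.rng c = L.rng a := by
  obtain ⟨b, hb, rfl⟩ := h
  exact L.rng_comp a b hb

theorem Extends.ident (a : L.Path) : L.Extends a (L.ident (L.rng a)) :=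
  ⟨a, L.src_ident _, L.ident_comp a⟩

theorem extends_ident_iff {a : L.Path} {v : L.Vertex} : L.Extends a (L.ident v) ↔ L.rng a = v := by
  constructor
  · intro h
    rw [h.rng_eq, L.rng_ident]
  · rintro rfl
    exact Extends.ident a

theorem Extends.eq_of_deg {a a' c : L.Path} (h : L.Extends c a) (h' : L.Extends c a')
    (hd : L.deg a = L.deg a') : a = a' := by
  obtain ⟨b, hb, rfl⟩ := h
  obtain ⟨b', hb', hc⟩ := h'
  exact (comp_eq_comp hc hd.symm).1.symm

theorem extends_comp_left {a b c : L.Path} {h : L.src a = L.rng b} {h' : L.src a = L.rng c} :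
    L.Extends (L.comp a b h) (L.comp a c h') ↔ L.Extends b c := by
  constructor
  · rintro ⟨d, hd, hc⟩
    have hd' : L.src c = L.rng d := by rw [← hd, L.src_comp]
    rw [L.assoc a c d h' hd'] at hc
    exact ⟨d, hd', comp_left_cancel hc⟩
  · rintro ⟨d, hd, rfl⟩
    exact ⟨d, by rw [L.src_comp, hd], L.assoc _ _ _ _ _⟩

/-- The part of a path of degree at most `n`. -/
theorem Extends.of_deg_le {a c e : L.Path} (hc : L.Extends c a) (he : L.Extends c e)
    (hd : L.deg a ≤ L.deg e) : L.Extends e a := by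
  obtain ⟨⟨a', b⟩, ⟨h1, -, h, hab⟩, -⟩ :=
    L.factorisation e (L.deg a) (L.deg e - L.deg a) (add_tsub_cancel_of_le hd).symm
  have hea : L.Extends e a' := ⟨b, h, hab⟩
  rwa [(he.trans hea).eq_of_deg hc h1] at hea

theorem exists_extends_deg {c : L.Path} {n : Fin k → ℕ} (hn : n ≤ L.deg c) :
    ∃ e, L.Extends c e ∧ L.deg e = n := by
  obtain ⟨⟨e, b⟩, ⟨h1, -, h, hab⟩, -⟩ :=
    L.factorisation c n (L.deg c - n) (add_tsub_cancel_of_le hn).symm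
  exact ⟨e, ⟨b, h, hab⟩, h1⟩

theorem Extends.deg_le {a c : L.Path} (h : L.Extends c a) : L.deg a ≤ L.deg c := by
  obtain ⟨b, hb, rfl⟩ := h
  rw [L.deg_comp]
  exact le_self_add

/-- Every common extension of `a` and `b` extends a minimal one. -/
theorem exists_minExt {a b c : L.Path} (ha : L.Extends c a) (hb : L.Extends c b) :
    ∃ p ∈ L.minExt a b, ∃ h, L.Extends c (L.comp a p.1 h) := by
  obtain ⟨e, hce, hde⟩ := exists_extends_deg (sup_le ha.deg_le hb.deg_le)
  have hea := ha.of_deg_le hce (hde ▸ le_sup_left)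
  have heb := hb.of_deg_le hce (hde ▸ le_sup_right)
  obtain ⟨x, hx, hax⟩ := id hea
  obtain ⟨y, hy, hby⟩ := id heb
  exact ⟨(x, y), ⟨hx, hy, hax.trans hby.symm, hax.symm ▸ ⟨hde, hea, heb⟩⟩, hx, hax.symm ▸ hce⟩

theorem minExt_swap {a b : L.Path} {p : L.Path × L.Path} (hp : p ∈ L.minExt a b) :
    p.swap ∈ L.minExt b a := by
  obtain ⟨ha, hb, hc, hd, h1, h2⟩ := hp
  refine ⟨hb, ha, hc.symm, ?_⟩
  change L.comp b p.2 hb ∈ _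
  rw [← hc]
  exact ⟨by rw [hd, sup_comm], h2, h1⟩

theorem minExt_deg {a b : L.Path} {p : L.Path × L.Path} (hp : p ∈ L.minExt a b) :
    L.deg a + L.deg p.1 = L.deg a ⊔ L.deg b := by
  obtain ⟨ha, hb, hc, hd, h1, h2⟩ := hp
  rw [← hd, L.deg_comp]

theorem minExt_ext {a b : L.Path} {p q : L.Path × L.Path} (hp : p ∈ L.minExt a b)
    (hq : q ∈ L.minExt a b) (h : p.1 = q.1) : p = q := by
  obtain ⟨ha, hb, hc, -⟩ := hp
  obtain ⟨ha', hb', hc', -⟩ := hq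
  obtain ⟨p1, p2⟩ := p
  obtain ⟨q1, q2⟩ := q
  obtain rfl : p1 = q1 := h
  obtain rfl : p2 = q2 := comp_left_cancel (hc.symm.trans hc')
  rfl

theorem minExt_src {a b : L.Path} {p : L.Path × L.Path} (hp : p ∈ L.minExt a b) :
    L.src p.1 = L.src p.2 := by
  obtain ⟨ha, hb, hc, -⟩ := hp
  have := congrArg L.src hc
  rwa [L.src_comp, L.src_comp] at this

theorem minExt_self (a : L.Path) :
    L.minExt a a = {(L.ident (L.src a), L.ident (L.src a))} := by
  have hmem : (L.ident (L.src a), L.ident (L.src a)) ∈ L.minExt a a := by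
    refine ⟨(L.rng_ident _).symm, (L.rng_ident _).symm, rfl, ?_⟩
    rw [L.comp_ident]
    exact ⟨(sup_idem _).symm, .refl a, .refl a⟩
  refine Set.eq_singleton_iff_unique_mem.2 ⟨hmem, fun p hp => minExt_ext hp hmem ?_⟩
  obtain ⟨ha, -, -, hd, -⟩ := id hp
  have hd' : L.deg (L.comp a p.1 ha) = L.deg (L.comp a (L.ident (L.src a)) (L.rng_ident _).symm) := by
    rw [hd, L.comp_ident, sup_idem]
  have h0 : L.deg p.1 = L.deg (L.ident (L.src a)) := by
    rw [L.deg_comp, L.deg_comp] at hd'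
    exact add_left_cancel hd'
  rw [ha]
  exact (Extends.refl p.1).eq_of_deg (Extends.ident p.1) (by rw [h0, L.deg_ident, L.deg_ident])

/-! ### Relations in Kumjian-Pask families -/

namespace IsKumjianPaskFamily

variable {A : Type*} [NonUnitalRing A] {S S' : L.Path → A}

theorem ident_mul (h : L.IsKumjianPaskFamily S S') (a : L.Path) :
    S (L.ident (L.rng a)) * S a = S a := by
  rw [h.kp2_path _ _ (L.src_ident _), L.ident_comp]

theorem mul_ident (h : L.IsKumjianPaskFamily S S') (a : L.Path) :
    S a * S (L.ident (L.src a)) = S a := by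
  rw [h.kp2_path _ _ (L.rng_ident _).symm, L.comp_ident]

theorem ghost_mul_ident (h : L.IsKumjianPaskFamily S S') (a : L.Path) :
    S' a * S (L.ident (L.rng a)) = S' a := by
  rw [← h.ghost_ident, h.kp2_ghost _ _ (L.src_ident _), L.ident_comp]

theorem ident_mul_ghost (h : L.IsKumjianPaskFamily S S') (a : L.Path) :
    S (L.ident (L.src a)) * S' a = S' a := by
  rw [← h.ghost_ident, h.kp2_ghost _ _ (L.rng_ident _).symm, L.comp_ident]

theorem path_mul_path (h : L.IsKumjianPaskFamily S S') {a b : L.Path} (hab : L.src a ≠ L.rng b) :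
    S a * S b = 0 := by
  rw [← h.mul_ident a, ← h.ident_mul b, mul_assoc, ← mul_assoc (S (L.ident _)),
    h.kp1_orth _ _ hab, zero_mul, mul_zero]

theorem ghost_mul_ghost (h : L.IsKumjianPaskFamily S S') {a b : L.Path} (hab : L.src a ≠ L.rng b) :
    S' b * S' a = 0 := by
  rw [← h.ghost_mul_ident b, ← h.ident_mul_ghost a, mul_assoc, ← mul_assoc (S (L.ident _)),
    h.kp1_orth _ _ hab.symm, zero_mul, mul_zero]

theorem ghost_mul_path_self (h : L.IsKumjianPaskFamily S S') (a : L.Path) :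
    S' a * S a = S (L.ident (L.src a)) := by
  rw [h.kp3, minExt_self, finsum_mem_singleton, h.ghost_ident, h.kp1_idem]

/-- In (KP3) each pair satisfies a p.1 = b p.2, so S_b can be pulled out to the left: the range
projection of a, seen behind b, becomes a sum of range projections. -/
theorem range_mul_path (hL : L.FinitelyAligned) (h : L.IsKumjianPaskFamily S S') (a b : L.Path) :
    S a * S' a * S b = ∑ p ∈ (hL a b).toFinset, S b * (S p.2 * S' p.2) := by
  rw [mul_assoc, h.kp3, finsum_mem_eq_finite_toFinset_sum _ (hL a b), Finset.mul_sum]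
  refine Finset.sum_congr rfl fun p hp => ?_
  obtain ⟨ha, hb, hc, -⟩ := (hL a b).mem_toFinset.1 hp
  rw [← mul_assoc, ← mul_assoc, h.kp2_path _ _ ha, h.kp2_path _ _ hb, hc]

theorem range_mul_range (hL : L.FinitelyAligned) (h : L.IsKumjianPaskFamily S S') (a b : L.Path) :
    (S a * S' a) * (S b * S' b) =
      ∑ p ∈ (hL a b).toFinset, (S a * S p.1) * (S' p.2 * S' b) := by
  rw [mul_assoc, ← mul_assoc (S' a), h.kp3, finsum_mem_eq_finite_toFinset_sum _ (hL a b),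
    Finset.sum_mul, Finset.mul_sum]
  exact Finset.sum_congr rfl fun p hp => by simp only [mul_assoc]

/-- Both products are sums over minimal common extensions, and swapping the pairs matches them term
by term. -/
theorem range_comm (hL : L.FinitelyAligned) (h : L.IsKumjianPaskFamily S S') (a b : L.Path) :
    (S a * S' a) * (S b * S' b) = (S b * S' b) * (S a * S' a) := by
  rw [h.range_mul_range hL, h.range_mul_range hL]
  refine Finset.sum_bij' (fun p _ => p.swap) (fun p _ => p.swap) ?_ ?_ ?_ ?_ ?_
  · intro p hp
    exact (hL b a).mem_toFinset.2 (minExt_swap ((hL a b).mem_toFinset.1 hp))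
  · intro p hp
    exact (hL a b).mem_toFinset.2 (minExt_swap ((hL b a).mem_toFinset.1 hp))
  · intro p _
    rfl
  · intro p _
    rfl
  · intro p hp
    obtain ⟨ha, hb, hc, -⟩ := (hL a b).mem_toFinset.1 hp
    simp only [Prod.fst_swap, Prod.snd_swap]
    rw [h.kp2_path _ _ ha, h.kp2_path _ _ hb, h.kp2_ghost _ _ ha, h.kp2_ghost _ _ hb, hc]

theorem range_left_comm (hL : L.FinitelyAligned) (h : L.IsKumjianPaskFamily S S') (a b : L.Path)
    (y : A) : (S a * S' a) * ((S b * S' b) * y) = (S b * S' b) * ((S a * S' a) * y) := by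
  rw [← mul_assoc, h.range_comm hL, mul_assoc]

theorem range_idem (h : L.IsKumjianPaskFamily S S') (a : L.Path) :
    (S a * S' a) * (S a * S' a) = S a * S' a := by
  rw [mul_assoc, ← mul_assoc (S' a), h.ghost_mul_path_self, h.ident_mul_ghost]

theorem ghost_mul_range (h : L.IsKumjianPaskFamily S S') (a : L.Path) :
    S' a * (S a * S' a) = S' a := by
  rw [← mul_assoc, h.ghost_mul_path_self, h.ident_mul_ghost]

end IsKumjianPaskFamily

/-! ### Cutting down by gap projections -/

section gapAct

variable {A : Type*} [NonUnitalRing A]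

/-- The element `(1 - S_{a₁} S_{a₁*}) ⋯ (1 - S_{aₙ} S_{aₙ*}) y`. -/
def gapAct (S S' : L.Path → A) : List L.Path → A →+ A
  | [] => AddMonoidHom.id A
  | a :: l => gapAct S S' l - (AddMonoidHom.mulLeft (S a * S' a)).comp (gapAct S S' l)

variable {S S' : L.Path → A}

theorem gapAct_nil (y : A) : gapAct S S' [] y = y := rfl

theorem gapAct_cons (a : L.Path) (l : List L.Path) (y : A) :
    gapAct S S' (a :: l) y = gapAct S S' l y - (S a * S' a) * gapAct S S' l y := rfl

theorem gapAct_append (l l' : List L.Path) (y : A) :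
    gapAct S S' (l ++ l') y = gapAct S S' l (gapAct S S' l' y) := by
  induction l with
  | nil => rfl
  | cons a l ih => rw [List.cons_append, gapAct_cons, gapAct_cons, ih]

theorem gapAct_mul (l : List L.Path) (y z : A) :
    gapAct S S' l (y * z) = gapAct S S' l y * z := by
  induction l with
  | nil => rfl
  | cons a l ih => rw [gapAct_cons, gapAct_cons, ih, sub_mul, mul_assoc, mul_assoc, mul_assoc]

theorem gapAct_eq_self {l : List L.Path} {y : A} (h : ∀ a ∈ l, (S a * S' a) * y = 0) :
    gapAct S S' l y = y := by
  induction l with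
  | nil => rfl
  | cons a l ih =>
    rw [gapAct_cons, ih fun b hb => h b (List.mem_cons_of_mem _ hb), h a List.mem_cons_self,
      sub_zero]

namespace IsKumjianPaskFamily

theorem range_mul_gapAct (hL : L.FinitelyAligned) (h : L.IsKumjianPaskFamily S S') (a : L.Path)
    (l : List L.Path) (y : A) :
    (S a * S' a) * gapAct S S' l y = gapAct S S' l ((S a * S' a) * y) := by
  induction l with
  | nil => rfl
  | cons b l ih =>
    rw [gapAct_cons, gapAct_cons, mul_sub, h.range_left_comm hL, ih]

theorem range_mul_gapAct_of_mem (hL : L.FinitelyAligned) (h : L.IsKumjianPaskFamily S S')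
    {a : L.Path} {l : List L.Path} (ha : a ∈ l) (y : A) :
    (S a * S' a) * gapAct S S' l y = 0 := by
  induction l with
  | nil => simp at ha
  | cons b l ih =>
    rw [gapAct_cons, mul_sub]
    rcases List.mem_cons.1 ha with rfl | ha
    · rw [← mul_assoc, h.range_idem, sub_self]
    · rw [h.range_left_comm hL, ih ha, mul_zero, sub_zero]

theorem ghost_mul_gapAct_of_mem (hL : L.FinitelyAligned) (h : L.IsKumjianPaskFamily S S')
    {a : L.Path} {l : List L.Path} (ha : a ∈ l) (y : A) :
    S' a * gapAct S S' l y = 0 := by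
  rw [← h.ghost_mul_range, mul_assoc, h.range_mul_gapAct_of_mem hL ha, mul_zero]

/-- Links the product in (KP4) with the unit-free operator `gapAct`; they agree where S_v acts as
the identity. -/
theorem gapProd_mul (h : L.IsKumjianPaskFamily S S') {v : L.Vertex} {l : List L.Path}
    (hl : ∀ a ∈ l, L.rng a = v) {y : A} (hy : S (L.ident v) * y = y) :
    gapProd S S' v l * y = gapAct S S' l y := by
  have key : S (L.ident v) * gapAct S S' l y = gapAct S S' l y ∧
      gapProd S S' v l * y = gapAct S S' l y := by
    induction l with
    | nil => exact ⟨hy, hy⟩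
    | cons a l ih =>
      obtain ⟨h1, h2⟩ := ih fun b hb => hl b (List.mem_cons_of_mem _ hb)
      have ha : S (L.ident v) * S a = S a := by
        rw [← hl a List.mem_cons_self, h.ident_mul]
      rw [gapAct_cons, gapProd]
      constructor
      · rw [mul_sub, h1, ← mul_assoc, ← mul_assoc, ha]
      · rw [mul_assoc, h2, sub_mul, h1]
  exact key.2

/-- If a gap projection does not vanish then some path avoids all of its members. -/
theorem exists_minExt_eq_empty (hL : L.FinitelyAligned) (h : L.IsKumjianPaskFamily S S')
    {v : L.Vertex} {l : List L.Path} (hl : ∀ a ∈ l, L.rng a = v)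
    (hne : gapAct S S' l (S (L.ident v)) ≠ 0) :
    ∃ e, L.rng e = v ∧ ∀ a ∈ l, L.minExt e a = ∅ := by
  classical
  by_contra! hcon
  apply hne
  -- Members of `FE v` must differ from v. If v were in the list, its gap factor would annihilate
  -- S_v.
  have hid : L.ident v ∉ l := fun hv => hne <| by
    have := h.range_mul_gapAct_of_mem hL hv (S (L.ident v))
    rw [h.range_mul_gapAct hL] at this
    rwa [h.ghost_ident, mul_assoc, h.kp1_idem, h.kp1_idem] at this
  have hE : l.toFinset ∈ L.FE v := by
    refine ⟨fun a ha => ?_, fun a ha => ?_⟩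
    · rw [List.mem_toFinset] at ha
      exact ⟨hl a ha, fun h' => hid (h' ▸ ha)⟩
    · obtain ⟨b, hb, hab⟩ := hcon a ha
      exact ⟨b, by simpa using hb, hab⟩
  have hz := h.kp4 v _ hE l.toFinset.toList (by simp)
  have hv : S (L.ident v) * gapAct S S' l (S (L.ident v)) = gapAct S S' l (S (L.ident v)) := by
    have h1 : S (L.ident v) = S (L.ident v) * S' (L.ident v) := by rw [h.ghost_ident, h.kp1_idem]
    conv_lhs => rw [h1, h.range_mul_gapAct hL, ← h1, h.kp1_idem]
  -- (KP4) concerns an enumeration of the set without repetitions, not `l` itself. Every q_a with a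
  -- in `l` already kills `gapAct S S' l (S_v)`, so the gap product over the set fixes this element,
  -- whereas (KP4) makes it zero.
  rw [← gapAct_eq_self (l := l.toFinset.toList) (S := S) (S' := S')
    (y := gapAct S S' l (S (L.ident v))), ← h.gapProd_mul _ hv, hz, zero_mul]
  · intro a ha
    exact hl a (by simpa using ha)
  · intro a ha
    exact h.range_mul_gapAct_of_mem hL (by simpa using ha) _

/-- Distinct paths of equal degree have no common extension, so their range projections are
orthogonal and the product of the 1 - q_a collapses to 1 - ∑ q_a. -/
theorem sub_sum_eq_gapAct (hL : L.FinitelyAligned) (h : L.IsKumjianPaskFamily S S')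
    (n : Fin k → ℕ) {l : List L.Path} (hd : ∀ a ∈ l, L.deg a = n) (hn : l.Nodup) (y : A) :
    y - (l.map fun a => (S a * S' a) * y).sum = gapAct S S' l y := by
  induction l with
  | nil => simp [gapAct_nil]
  | cons a l ih =>
    have hz : gapAct S S' l ((S a * S' a) * y) = (S a * S' a) * y := by
      refine gapAct_eq_self fun b hb => ?_
      have hab : L.minExt b a = ∅ := by
        refine Set.eq_empty_of_forall_notMem fun p hp => (List.nodup_cons.1 hn).1 ?_
        obtain ⟨_, _, -, -, h1, h2⟩ := hp
        rwa [h2.eq_of_deg h1 (by rw [hd a List.mem_cons_self, hd b (List.mem_cons_of_mem _ hb)])]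
      rw [← mul_assoc, ← mul_assoc, mul_assoc (S b), h.kp3, hab]
      simp
    rw [gapAct_cons, h.range_mul_gapAct hL, hz,
      ← ih (fun b hb => hd b (List.mem_cons_of_mem _ hb)) (List.nodup_cons.1 hn).2,
      List.map_cons, List.sum_cons]
    abel

/-- Gap projections move past paths. -/
theorem exists_gapAct_path (hL : L.FinitelyAligned) (h : L.IsKumjianPaskFamily S S')
    (l : List L.Path) (b : L.Path) :
    ∃ l' : List L.Path, (∀ a ∈ l', L.rng a = L.src b) ∧
      gapAct S S' l (S b) = S b * gapAct S S' l' (S (L.ident (L.src b))) := by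
  classical
  induction l with
  | nil => exact ⟨[], by simp, (h.mul_ident b).symm⟩
  | cons a l ih =>
    obtain ⟨l', hl', ih⟩ := ih
    -- These are the second members τ of the pairs in Λ^min(a, b), for which q_a S_b = S_b ∑ q_τ.
    -- All have degree (d(a) ∨ d(b)) - d(b), so 1 - ∑ q_τ is again a gap product and can be put in
    -- front of `l'`.
    let F := (hL a b).toFinset.image Prod.snd
    have hF : ∀ c ∈ F, ∃ p ∈ L.minExt a b, p.2 = c := by
      intro c hc
      obtain ⟨p, hp, rfl⟩ := Finset.mem_image.1 hc
      exact ⟨p, (hL a b).mem_toFinset.1 hp, rfl⟩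
    refine ⟨F.toList ++ l', ?_, ?_⟩
    · intro c hc
      rcases List.mem_append.1 hc with hc | hc
      · obtain ⟨p, ⟨ha, hb, -⟩, rfl⟩ := hF c (by simpa using hc)
        exact hb.symm
      · exact hl' c hc
    · rw [gapAct_cons, ih, gapAct_append, ← mul_assoc, h.range_mul_path hL,
        ← h.sub_sum_eq_gapAct hL (L.deg a ⊔ L.deg b - L.deg b) _ F.nodup_toList, mul_sub,
        Finset.sum_map_toList, Finset.sum_image, Finset.sum_mul, Finset.mul_sum]
      · simp only [mul_assoc]
      · intro p hp q hq hpq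
        have := minExt_ext (minExt_swap ((hL a b).mem_toFinset.1 hp))
          (minExt_swap ((hL a b).mem_toFinset.1 hq)) hpq
        exact Prod.swap_injective this
      · intro c hc
        obtain ⟨p, hp, rfl⟩ := hF c (by simpa using hc)
        have := minExt_deg (minExt_swap hp)
        rw [sup_comm, ← this, Prod.fst_swap, add_tsub_cancel_left]

/-- A non-zero element stays non-zero when cut down to a piece on which every member of `M` either
is an initial segment or has been removed. -/
theorem exists_cut (hL : L.FinitelyAligned) (h : L.IsKumjianPaskFamily S S') (x : A)
    (M : List L.Path) {v : L.Path} (hx : x * S v ≠ 0) :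
    ∃ (l : List L.Path) (b : L.Path), x * gapAct S S' l (S b) ≠ 0 ∧
      ∀ m ∈ M, m ∈ l ∨ L.Extends b m := by
  induction M with
  | nil => exact ⟨[], v, hx, by simp⟩
  | cons m M ih =>
    obtain ⟨l, b, hne, hM⟩ := ih
    -- If removing q_m keeps the element non-zero, m joins the list. Otherwise all of the element
    -- lies under q_m, which splits S_b into terms S_{bτ} S_{τ*} with bτ extending m; some term is
    -- non-zero, and b is replaced by that bτ.
    by_cases h0 : x * gapAct S S' (m :: l) (S b) = 0
    · rw [gapAct_cons, mul_sub, sub_eq_zero, h.range_mul_gapAct hL, h.range_mul_path hL, map_sum,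
        Finset.mul_sum] at h0
      rw [h0] at hne
      obtain ⟨p, hp, hpne⟩ := Finset.exists_ne_zero_of_sum_ne_zero hne
      obtain ⟨ha, hb, hc, -⟩ := (hL m b).mem_toFinset.1 hp
      rw [← mul_assoc, gapAct_mul, ← mul_assoc, h.kp2_path _ _ hb] at hpne
      refine ⟨l, L.comp b p.2 hb, left_ne_zero_of_mul hpne, fun c hc' => ?_⟩
      rcases List.mem_cons.1 hc' with rfl | hc'
      · exact .inr (hc ▸ extends_comp _ _ ha)
      · exact (hM c hc').imp_right fun h => (extends_comp b p.2 hb).trans h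
    · refine ⟨m :: l, b, h0, fun c hc => ?_⟩
      rcases List.mem_cons.1 hc with rfl | hc
      · exact .inl List.mem_cons_self
      · exact (hM c hc).imp_left (List.mem_cons_of_mem _)

end IsKumjianPaskFamily

end gapAct

end HigherRankGraph

namespace HigherRankGraph

variable {k : ℕ} (L : HigherRankGraph.{u} k)

/-! ### The boundary of a higher-rank graph -/

open Classical in
/-- Concatenation with `a` on the left; paths that do not start at the source of `a` are fixed. -/
noncomputable def prepend (a b : L.Path) : L.Path :=
  if h : L.src a = L.rng b then L.comp a b h else b

open Classical in
/-- Removal of the initial segment `a`; paths that do not extend `a` are fixed. -/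
noncomputable def remove (a c : L.Path) : L.Path :=
  if h : L.Extends c a then h.choose else c

/-- The filter of the sets of paths that contain a dense open set, where the basic open sets are the
sets of the extensions of a path. -/
def genericFilter : Filter L.Path where
  sets := {s | ∀ y, ∃ y', L.Extends y' y ∧ ∀ z, L.Extends z y' → z ∈ s}
  univ_sets := fun y => ⟨y, .refl y, fun _ _ => trivial⟩
  sets_of_superset := fun hs hst y => (hs y).imp fun _ h => ⟨h.1, fun z hz => hst (h.2 z hz)⟩
  inter_sets := fun hs ht y => by
    obtain ⟨y₁, h₁, hs⟩ := hs y
    obtain ⟨y₂, h₂, ht⟩ := ht y₁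
    exact ⟨y₂, h₂.trans h₁, fun z hz => ⟨hs z (hz.trans h₂), ht z hz⟩⟩

variable {L}

theorem prepend_of_eq {a b : L.Path} (h : L.src a = L.rng b) : L.prepend a b = L.comp a b h :=
  dif_pos h

theorem remove_comp {a b : L.Path} (h : L.src a = L.rng b) : L.remove a (L.comp a b h) = b := by
  have hex := extends_comp a b h
  rw [remove, dif_pos hex]
  exact comp_left_cancel hex.choose_spec.choose_spec

/-- Inside the extensions of y, enter the dense open set below ay and cancel a. If a and y do not
compose, no extension of y composes with a, and the map is the identity there. -/
theorem tendsto_prepend (a : L.Path) :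
    Filter.Tendsto (L.prepend a) L.genericFilter L.genericFilter := by
  intro s hs y
  by_cases h : L.src a = L.rng y
  · obtain ⟨y', hy', hs⟩ := hs (L.comp a y h)
    obtain ⟨c, hc, rfl⟩ := hy'
    have hc' : L.src y = L.rng c := by rw [← hc, L.src_comp]
    refine ⟨L.comp y c hc', extends_comp _ _ _, fun z hz => ?_⟩
    have hz' : L.src a = L.rng z := by rw [hz.rng_eq, L.rng_comp, h]
    rw [Set.mem_preimage, prepend_of_eq hz']
    apply hs
    rw [L.assoc a y c h hc']
    exact extends_comp_left.2 hz
  · obtain ⟨y', hy', hs⟩ := hs y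
    refine ⟨y', hy', fun z hz => ?_⟩
    have hz' : ¬ L.src a = L.rng z := by rwa [hz.rng_eq, hy'.rng_eq]
    rw [Set.mem_preimage, prepend, dif_neg hz']
    exact hs z hz

/-- If y and a have a common extension ab, refine b into the dense open set and put a back.
Otherwise no extension of y extends a, and the map is the identity there. -/
theorem tendsto_remove (a : L.Path) :
    Filter.Tendsto (L.remove a) L.genericFilter L.genericFilter := by
  intro s hs y
  by_cases h : ∃ c, L.Extends c y ∧ L.Extends c a
  · obtain ⟨c, hcy, b, hb, rfl⟩ := h
    obtain ⟨b', hb', hs⟩ := hs b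
    have hab : L.src a = L.rng b' := by rw [hb'.rng_eq, hb]
    refine ⟨L.comp a b' hab, (extends_comp_left.2 hb').trans hcy, fun z hz => ?_⟩
    obtain ⟨d, hd, rfl⟩ := hz.trans (extends_comp a b' hab)
    rw [Set.mem_preimage, remove_comp]
    exact hs d (extends_comp_left.1 hz)
  · obtain ⟨y', hy', hs⟩ := hs y
    refine ⟨y', hy', fun z hz => ?_⟩
    rw [Set.mem_preimage, remove, dif_neg fun hza => h ⟨z, hz.trans hy', hza⟩]
    exact hs z hz

variable (L) in
/-- The generic ultrafilters on the paths, with a degree. -/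
abbrev Boundary : Type u :=
  {U : Ultrafilter L.Path // (U : Filter L.Path) ≤ L.genericFilter} × (Fin k → ℤ)

/-- The cone of the boundary points that begin with `a`. -/
def cone (a : L.Path) : Set L.Boundary := {x | ∀ᶠ y in (x.1.1 : Filter L.Path), L.Extends y a}

/-- The degree of a path in `ℤ^k`. -/
def degInt (a : L.Path) : Fin k → ℤ := fun i => L.deg a i

theorem degInt_comp (a b : L.Path) (h) : degInt (L.comp a b h) = degInt a + degInt b := by
  funext i
  simp [degInt, L.deg_comp]

/-- The boundary point `a x`. -/
noncomputable def shiftIn (a : L.Path) (x : L.Boundary) : L.Boundary :=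
  (⟨x.1.1.map (L.prepend a), (Filter.map_mono x.1.2).trans (tendsto_prepend a)⟩, x.2 + degInt a)

/-- The boundary point `y` with `x = a y`. -/
noncomputable def shiftOut (a : L.Path) (x : L.Boundary) : L.Boundary :=
  (⟨x.1.1.map (L.remove a), (Filter.map_mono x.1.2).trans (tendsto_remove a)⟩, x.2 - degInt a)

/-! ### Cones and the two mutually inverse shifts -/

theorem boundary_ext {x y : L.Boundary} (h : (x.1.1 : Filter L.Path) = y.1.1) (h' : x.2 = y.2) :
    x = y :=
  Prod.ext (Subtype.ext (Ultrafilter.coe_injective h)) h'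

theorem mem_cone {a : L.Path} {x : L.Boundary} :
    x ∈ cone a ↔ ∀ᶠ y in (x.1.1 : Filter L.Path), L.Extends y a := Iff.rfl

theorem cone_mono {a b : L.Path} (h : L.Extends b a) {x : L.Boundary} (hx : x ∈ cone b) :
    x ∈ cone a :=
  (mem_cone.1 hx).mono fun _ hy => hy.trans h

theorem eq_of_mem_cone {a b : L.Path} {x : L.Boundary} (ha : x ∈ cone a) (hb : x ∈ cone b)
    (hd : L.deg a = L.deg b) : a = b := by
  obtain ⟨y, hya, hyb⟩ := ((mem_cone.1 ha).and hb).exists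
  exact hya.eq_of_deg hyb hd

theorem shiftIn_mem_cone {a b : L.Path} (h : L.src a = L.rng b) {x : L.Boundary} (hx : x ∈ cone b) :
    shiftIn a x ∈ cone (L.comp a b h) := by
  refine (mem_cone.1 hx).mono fun y hy => ?_
  rw [prepend_of_eq (h.trans hy.rng_eq.symm)]
  exact extends_comp_left.2 hy

theorem shiftIn_mem_cone_self {a : L.Path} {x : L.Boundary} (hx : x ∈ cone (L.ident (L.src a))) :
    shiftIn a x ∈ cone a := by
  have := shiftIn_mem_cone (L.rng_ident _).symm hx
  rwa [L.comp_ident] at this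

theorem shiftOut_mem_cone {a b : L.Path} (h : L.src a = L.rng b) {x : L.Boundary} (ha : x ∈ cone a) :
    shiftOut a x ∈ cone b ↔ x ∈ cone (L.comp a b h) := by
  refine Filter.eventually_congr ((mem_cone.1 ha).mono fun y hy => ?_)
  obtain ⟨c, hc, rfl⟩ := hy
  rw [remove_comp, extends_comp_left]
  rfl

theorem shiftOut_mem_cone_ident {a : L.Path} {x : L.Boundary} (ha : x ∈ cone a) :
    shiftOut a x ∈ cone (L.ident (L.src a)) := by
  rw [shiftOut_mem_cone (L.rng_ident _).symm ha, L.comp_ident]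
  exact ha

theorem shiftOut_shiftIn {a : L.Path} {x : L.Boundary} (hx : x ∈ cone (L.ident (L.src a))) :
    shiftOut a (shiftIn a x) = x := by
  refine boundary_ext ?_ (add_sub_cancel_right _ _)
  change Filter.map (L.remove a) (Filter.map (L.prepend a) x.1.1) = x.1.1
  rw [Filter.map_map]
  refine (Filter.map_congr ((mem_cone.1 hx).mono fun y hy => ?_)).trans Filter.map_id
  have h : L.src a = L.rng y := (extends_ident_iff.1 hy).symm
  rw [Function.comp_apply, prepend_of_eq h, remove_comp, id]

theorem shiftIn_shiftOut {a : L.Path} {x : L.Boundary} (hx : x ∈ cone a) :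
    shiftIn a (shiftOut a x) = x := by
  refine boundary_ext ?_ (sub_add_cancel _ _)
  change Filter.map (L.prepend a) (Filter.map (L.remove a) x.1.1) = x.1.1
  rw [Filter.map_map]
  refine (Filter.map_congr ((mem_cone.1 hx).mono fun y hy => ?_)).trans Filter.map_id
  obtain ⟨c, hc, rfl⟩ := hy
  rw [Function.comp_apply, remove_comp, prepend_of_eq hc, id]

theorem shiftIn_comp {a b : L.Path} (h : L.src a = L.rng b) {x : L.Boundary}
    (hx : x ∈ cone (L.ident (L.src b))) :
    shiftIn (L.comp a b h) x = shiftIn a (shiftIn b x) := by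
  refine boundary_ext ?_ ?_
  · change Filter.map (L.prepend (L.comp a b h)) x.1.1 =
      Filter.map (L.prepend a) (Filter.map (L.prepend b) x.1.1)
    rw [Filter.map_map]
    refine Filter.map_congr ((mem_cone.1 hx).mono fun y hy => ?_)
    have hy' : L.src b = L.rng y := (extends_ident_iff.1 hy).symm
    rw [Function.comp_apply, prepend_of_eq ((L.src_comp a b h).trans hy'), prepend_of_eq hy',
      prepend_of_eq (h.trans (L.rng_comp b y hy').symm), L.assoc a b y h hy']
  · change x.2 + _ = x.2 + _ + _
    rw [degInt_comp, add_assoc, add_comm (degInt b)]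

theorem shiftOut_comp {a b : L.Path} (h : L.src a = L.rng b) {x : L.Boundary}
    (hx : x ∈ cone (L.comp a b h)) :
    shiftOut (L.comp a b h) x = shiftOut b (shiftOut a x) := by
  have ha : x ∈ cone a := cone_mono (extends_comp a b h) hx
  have hb := (shiftOut_mem_cone h ha).2 hx
  have hz := shiftOut_mem_cone_ident hb
  conv_lhs => rw [← shiftIn_shiftOut ha, ← shiftIn_shiftOut hb, ← shiftIn_comp h hz]
  exact shiftOut_shiftIn (by rwa [L.src_comp])

theorem shiftIn_ident {v : L.Vertex} {x : L.Boundary} (hx : x ∈ cone (L.ident v)) :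
    shiftIn (L.ident v) x = x := by
  refine boundary_ext ?_ ?_
  · refine (Filter.map_congr ((mem_cone.1 hx).mono fun y hy => ?_)).trans Filter.map_id
    obtain rfl := extends_ident_iff.1 hy
    rw [prepend_of_eq (L.src_ident _), L.ident_comp, id]
  · change x.2 + _ = x.2
    have : degInt (L.ident v) = 0 := by
      funext i
      simp [degInt, L.deg_ident]
    rw [this, add_zero]

theorem shiftOut_ident {v : L.Vertex} {x : L.Boundary} (hx : x ∈ cone (L.ident v)) :
    shiftOut (L.ident v) x = x := by
  conv_lhs => rw [← shiftIn_ident hx]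
  exact shiftOut_shiftIn (by rwa [L.src_ident])

/-- Every generic set contains a path with range v, so the generic filter restricted to these paths
is proper and has an ultrafilter below it. The degree label 0 is arbitrary. -/
theorem exists_mem_cone_ident (v : L.Vertex) :
    ∃ x : L.Boundary, x ∈ cone (L.ident v) := by
  have hne : (L.genericFilter ⊓ Filter.principal {y | L.Extends y (L.ident v)}).NeBot := by
    refine Filter.inf_principal_neBot_iff.2 fun s hs => ?_
    obtain ⟨y', hy', hs⟩ := hs (L.ident v)
    exact ⟨y', hs y' (.refl _), hy'⟩
  have hle := Ultrafilter.of_le (L.genericFilter ⊓ Filter.principal {y | L.Extends y (L.ident v)})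
  exact ⟨(⟨_, hle.trans inf_le_left⟩, 0), hle (Filter.mem_inf_of_right (Filter.mem_principal_self _))⟩

/-- A boundary point that begins with both `a` and `b` begins with a minimal common extension. -/
theorem exists_mem_cone_minExt (hL : L.FinitelyAligned) {a b : L.Path} {x : L.Boundary}
    (ha : x ∈ cone a) (hb : x ∈ cone b) :
    ∃ p ∈ L.minExt a b, ∃ h, x ∈ cone (L.comp a p.1 h) := by
  have h : ∀ᶠ y in (x.1.1 : Filter L.Path),
      ∃ p ∈ L.minExt a b, ∃ h, L.Extends y (L.comp a p.1 h) :=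
    ((mem_cone.1 ha).and hb).mono fun y hy => exists_minExt hy.1 hy.2
  -- Finite alignment makes this union finite, so the ultrafilter selects one of its members.
  have h2 : (⋃ p ∈ L.minExt a b, {y | ∃ h, L.Extends y (L.comp a p.1 h)}) ∈ x.1.1 := by
    refine Filter.mem_of_superset h fun y hy => ?_
    simpa using hy
  obtain ⟨p, hp, hpx⟩ := (Ultrafilter.finite_biUnion_mem_iff (hL a b)).1 h2
  obtain ⟨y, hab, -⟩ := (Filter.Eventually.exists (f := (x.1.1 : Filter L.Path)) hpx)
  exact ⟨p, hp, hab, Filter.mem_of_superset hpx fun y hy => hy.2⟩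

/-- A boundary point with range `v` begins with a member of each finite exhaustive set at `v`. -/
theorem exists_mem_cone_of_mem_FE {v : L.Vertex} {E : Finset L.Path} (hE : E ∈ L.FE v)
    {x : L.Boundary} (hx : x ∈ cone (L.ident v)) : ∃ a ∈ E, x ∈ cone a := by
  -- Exhaustiveness as density: every path with range v can be prolonged to extend a member of E.
  have hg : {y | L.rng y = v → ∃ a ∈ E, L.Extends y a} ∈ L.genericFilter := by
    intro y
    by_cases hy : L.rng y = v
    · obtain ⟨a, ha, p, h1, h2, h3, h4⟩ := hE.2 y hy
      exact ⟨_, extends_comp y p.1 h1, fun z hz _ => ⟨a, ha, hz.trans h4.2.2⟩⟩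
    · exact ⟨y, .refl y, fun z hz hzv => absurd (hz.rng_eq ▸ hzv) hy⟩
  have h2 : (⋃ a ∈ (E : Set L.Path), {y | L.Extends y a}) ∈ x.1.1 := by
    refine Filter.mem_of_superset (Filter.inter_mem (x.1.2 hg) hx) fun y hy => ?_
    simpa using hy.1 (extends_ident_iff.1 hy.2)
  obtain ⟨a, ha, hax⟩ := (Ultrafilter.finite_biUnion_mem_iff E.finite_toSet).1 h2
  exact ⟨a, ha, hax⟩

/-! ### The boundary representation -/

/-! ### Partial composition operators on `ℓ²` -/

section WeightedComp

variable {I : Type*}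

/-- The Hilbert space of square-summable functions on a set. -/
noncomputable abbrev Hilb (I : Type*) := lp (fun _ : I => ℂ) 2

open Classical in
-- By injectivity on D each value of ξ is used at most once. The finite bound is kept because it
-- also gives operator norm at most 1.
theorem memℓp_ite_comp {D : Set I} {f : I → I} (hf : Set.InjOn f D) (ξ : Hilb I) :
    Memℓp (fun i => if i ∈ D then ξ (f i) else 0) 2 ∧
      ∀ s : Finset I, ∑ i ∈ s, ‖(if i ∈ D then ξ (f i) else 0 : ℂ)‖ ^ (2 : ℝ) ≤ ‖ξ‖ ^ (2 : ℝ) := by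
  have key : ∀ s : Finset I,
      ∑ i ∈ s, ‖(if i ∈ D then ξ (f i) else 0 : ℂ)‖ ^ (2 : ℝ) ≤ ‖ξ‖ ^ (2 : ℝ) := by
    intro s
    have h1 : ∑ i ∈ s, ‖(if i ∈ D then ξ (f i) else 0 : ℂ)‖ ^ (2 : ℝ) =
        ∑ i ∈ s with i ∈ D, ‖ξ (f i)‖ ^ (2 : ℝ) := by
      rw [Finset.sum_filter]
      refine Finset.sum_congr rfl fun i _ => ?_
      split_ifs <;> simp
    rw [h1, ← Finset.sum_image (f := fun i => ‖ξ i‖ ^ (2 : ℝ)) (g := f)]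
    · have := lp.sum_rpow_le_norm_rpow (p := 2) (by norm_num) ξ
        ((s.filter (· ∈ D)).image f)
      simpa using this
    · intro i hi j hj hij
      exact hf (Finset.mem_filter.1 hi).2 (Finset.mem_filter.1 hj).2 hij
  refine ⟨memℓp_gen' (C := ‖ξ‖ ^ (2 : ℝ)) fun s => ?_, key⟩
  simpa using key s

open Classical in
/-- The operator `ξ ↦ 1_D · (ξ ∘ f)`, for a map `f` that is injective on `D`. -/
noncomputable def compOp {D : Set I} {f : I → I} (hf : Set.InjOn f D) : Hilb I →L[ℂ] Hilb I :=
  LinearMap.mkContinuous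
    { toFun := fun ξ => ⟨fun i => if i ∈ D then ξ (f i) else 0, (memℓp_ite_comp hf ξ).1⟩
      map_add' := fun ξ η => by
        ext i
        change (if i ∈ D then (ξ + η) (f i) else 0) =
          (if i ∈ D then ξ (f i) else 0) + (if i ∈ D then η (f i) else 0)
        split_ifs <;> simp
      map_smul' := fun c ξ => by
        ext i
        by_cases hi : i ∈ D <;> simp [hi] } 1 fun ξ => by
    rw [one_mul]
    refine lp.norm_le_of_forall_sum_le (by norm_num) (norm_nonneg _) fun s => ?_
    simpa using (memℓp_ite_comp hf ξ).2 s

open Classical in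
theorem compOp_apply {D : Set I} {f : I → I} (hf : Set.InjOn f D) (ξ : Hilb I) (i : I) :
    compOp hf ξ i = if i ∈ D then ξ (f i) else 0 := rfl

/-- The maps f and g are inverse bijections between D and D', so reindexing the inner product turns
one operator into the adjoint of the other. -/
theorem star_compOp {D D' : Set I} {f g : I → I} (hf : Set.InjOn f D) (hg : Set.InjOn g D')
    (hfm : Set.MapsTo f D D') (hgm : Set.MapsTo g D' D) (hfg : ∀ i ∈ D, g (f i) = i)
    (hgf : ∀ i ∈ D', f (g i) = i) : star (compOp hf) = compOp hg := by
  classical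
  rw [ContinuousLinearMap.star_eq_adjoint]
  symm
  rw [ContinuousLinearMap.eq_adjoint_iff]
  intro ξ η
  rw [lp.inner_eq_tsum, lp.inner_eq_tsum]
  have h1 : ∀ i, inner ℂ (compOp hg ξ i) (η i) =
      D'.indicator (fun i => inner ℂ (ξ (g i)) (η i)) i := by
    intro i
    rw [compOp_apply, Set.indicator]
    split_ifs <;> simp
  have h2 : ∀ i, inner ℂ (ξ i) (compOp hf η i) =
      D.indicator (fun i => inner ℂ (ξ i) (η (f i))) i := by
    intro i
    rw [compOp_apply, Set.indicator]
    split_ifs <;> simp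
  simp only [h1, h2]
  rw [← tsum_subtype, ← tsum_subtype]
  let e : D' ≃ D :=
    { toFun := fun i => ⟨g i, hgm i.2⟩
      invFun := fun i => ⟨f i, hfm i.2⟩
      left_inv := fun i => Subtype.ext (hgf i i.2)
      right_inv := fun i => Subtype.ext (hfg i i.2) }
  rw [← e.tsum_eq]
  refine tsum_congr fun i => ?_
  change _ = inner ℂ (ξ (g i)) (η (f (g i)))
  rw [hgf i i.2]

end WeightedComp

theorem injOn_shiftOut (a : L.Path) : Set.InjOn (shiftOut a) (cone a) :=
  Set.LeftInvOn.injOn (f₁' := shiftIn a) fun _ hx => shiftIn_shiftOut hx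

theorem injOn_shiftIn (a : L.Path) : Set.InjOn (shiftIn a) (cone (L.ident (L.src a))) :=
  Set.LeftInvOn.injOn (f₁' := shiftOut a) fun _ hx => shiftOut_shiftIn hx

/-- The operator of a path in the boundary representation. -/
noncomputable def bdryOp (a : L.Path) : Hilb L.Boundary →L[ℂ] Hilb L.Boundary :=
  compOp (injOn_shiftOut a)

open Classical in
theorem bdryOp_apply (a : L.Path) (ξ : Hilb L.Boundary) (x : L.Boundary) :
    bdryOp a ξ x = if x ∈ cone a then ξ (shiftOut a x) else 0 := rfl

open Classical in
theorem star_bdryOp_apply (a : L.Path) (ξ : Hilb L.Boundary) (x : L.Boundary) :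
    star (bdryOp a) ξ x = if x ∈ cone (L.ident (L.src a)) then ξ (shiftIn a x) else 0 := by
  rw [bdryOp, star_compOp (injOn_shiftOut a) (injOn_shiftIn a)
    (fun _ hx => shiftOut_mem_cone_ident hx) (fun _ hx => shiftIn_mem_cone_self hx)
    (fun _ hx => shiftIn_shiftOut hx) (fun _ hx => shiftOut_shiftIn hx)]
  rfl

open Classical in
theorem bdryOp_star_apply (a : L.Path) (ξ : Hilb L.Boundary) (x : L.Boundary) :
    bdryOp a (star (bdryOp a) ξ) x = if x ∈ cone a then ξ x else 0 := by
  rw [bdryOp_apply, star_bdryOp_apply]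
  split_ifs with h1 h2
  · rw [shiftIn_shiftOut h1]
  · exact absurd (shiftOut_mem_cone_ident h1) h2
  · rfl

open Classical in
theorem bdryOp_ident_apply (v : L.Vertex) (ξ : Hilb L.Boundary) (x : L.Boundary) :
    bdryOp (L.ident v) ξ x = if x ∈ cone (L.ident v) then ξ x else 0 := by
  rw [bdryOp_apply]
  split_ifs with h
  · rw [shiftOut_ident h]
  · rfl

open Classical in
-- (KP3) pointwise. If ax also begins with b, it begins with a minimal common extension of a and b,
-- and with only one because these all have the same degree; hence exactly one summand is active at
-- x.
theorem star_bdryOp_mul_apply (hL : L.FinitelyAligned) (a b : L.Path) (ξ : Hilb L.Boundary)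
    (x : L.Boundary) : star (bdryOp a) (bdryOp b ξ) x =
      ∑ p ∈ (hL a b).toFinset, bdryOp p.1 (star (bdryOp p.2) ξ) x := by
  -- An active summand equals the whole left side: x = p.1 w gives ax = b p.2 w, so both sides
  -- evaluate ξ at p.2 w.
  have hterm : ∀ p ∈ L.minExt a b, bdryOp p.1 (star (bdryOp p.2) ξ) x =
      if x ∈ cone p.1 then star (bdryOp a) (bdryOp b ξ) x else 0 := by
    intro p hp
    obtain ⟨ha, hb, hc, -⟩ := id hp
    rw [bdryOp_apply]
    split_ifs with hx
    · have hz := shiftOut_mem_cone_ident hx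
      have hz2 := hz
      rw [minExt_src hp] at hz2
      have hx0 : x ∈ cone (L.ident (L.src a)) := by
        refine cone_mono ?_ hx
        rw [extends_ident_iff, ha]
      have hax := shiftIn_mem_cone ha hx
      have hbx : shiftIn a x ∈ cone b := by
        rw [hc] at hax
        exact cone_mono (extends_comp _ _ _) hax
      have heq : shiftIn a x = shiftIn b (shiftIn p.2 (shiftOut p.1 x)) := by
        conv_lhs => rw [← shiftIn_shiftOut hx, ← shiftIn_comp ha hz]
        rw [← shiftIn_comp hb hz2]
        simp only [hc]
      rw [star_bdryOp_apply, if_pos hz2, star_bdryOp_apply, if_pos hx0, bdryOp_apply, if_pos hbx,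
        heq, shiftOut_shiftIn]
      refine cone_mono ?_ (shiftIn_mem_cone_self hz2)
      rw [extends_ident_iff, hb]
    · rfl
  rw [Finset.sum_congr rfl fun p hp => hterm p ((hL a b).mem_toFinset.1 hp)]
  by_cases h0 : x ∈ cone (L.ident (L.src a)) ∧ shiftIn a x ∈ cone b
  · obtain ⟨p, hp, hap, hpx⟩ := exists_mem_cone_minExt hL (shiftIn_mem_cone_self h0.1) h0.2
    have hpx' : x ∈ cone p.1 := by
      rw [← shiftOut_mem_cone hap (shiftIn_mem_cone_self h0.1), shiftOut_shiftIn h0.1] at hpx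
      exact hpx
    rw [Finset.sum_eq_single p, if_pos hpx']
    · intro q hq hqp
      rw [if_neg fun hqx => hqp ?_]
      have hq := (hL a b).mem_toFinset.1 hq
      refine minExt_ext hq hp (eq_of_mem_cone hqx hpx' ?_)
      exact add_left_cancel ((minExt_deg hq).trans (minExt_deg hp).symm)
    · intro hp'
      exact absurd ((hL a b).mem_toFinset.2 hp) hp'
  · have hz : star (bdryOp a) (bdryOp b ξ) x = 0 := by
      rw [star_bdryOp_apply, bdryOp_apply]
      by_cases h1 : x ∈ cone (L.ident (L.src a))
      · rw [if_neg fun h2 => h0 ⟨h1, h2⟩, ite_self]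
      · rw [if_neg h1]
    rw [hz]
    simp

/-- Each factor is multiplication by the indicator of the cone of v minus that of a cone, so one
cone containing x suffices to kill the product at x. -/
theorem gapProd_bdryOp_apply {v : L.Vertex} {l : List L.Path} {x : L.Boundary}
    (hx : x ∈ cone (L.ident v) → ∃ a ∈ l, x ∈ cone a) (ξ : Hilb L.Boundary) :
    gapProd (L := L) bdryOp (fun a => star (bdryOp a)) v l ξ x = 0 := by
  classical
  induction l with
  | nil =>
    rw [gapProd, bdryOp_ident_apply, if_neg]
    simpa using hx
  | cons a l ih =>
    rw [gapProd, mul_apply_eq_comp, sub_apply, lp.coeFn_sub,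
      Pi.sub_apply, mul_apply_eq_comp, bdryOp_star_apply, bdryOp_ident_apply]
    by_cases h1 : x ∈ cone (L.ident v) → ∃ b ∈ l, x ∈ cone b
    · rw [ih h1]
      simp
    · push Not at h1
      obtain ⟨b, hb, hbx⟩ := hx h1.1
      rcases List.mem_cons.1 hb with rfl | hb
      · rw [if_pos h1.1, if_pos hbx, sub_self]
      · exact absurd hbx (h1.2 b hb)

/-- The boundary representation. -/
theorem bdryOp_isCuntzKriegerFamily (hL : L.FinitelyAligned) :
    L.IsCuntzKriegerFamily (bdryOp (L := L)) := by
  classical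
  refine ⟨fun a => ?_, fun v => ⟨?_, ?_⟩, fun v v' hv => ?_, fun a b h => ?_, fun a b => ?_,
    fun v E hE l hl => ?_⟩
  · ext ξ x
    change bdryOp a ξ x = bdryOp a (star (bdryOp a) (bdryOp a ξ)) x
    rw [bdryOp_star_apply, bdryOp_apply]
    split_ifs <;> rfl
  · ext ξ x
    change bdryOp (L.ident v) (bdryOp (L.ident v) ξ) x = _
    rw [bdryOp_ident_apply, bdryOp_ident_apply]
    split_ifs <;> rfl
  · ext ξ x
    rw [star_bdryOp_apply, bdryOp_ident_apply, L.src_ident]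
    split_ifs with h
    · rw [shiftIn_ident h]
    · rfl
  · ext ξ x
    change bdryOp (L.ident v) (bdryOp (L.ident v') ξ) x = 0
    rw [bdryOp_ident_apply, bdryOp_ident_apply]
    split_ifs with h1 h2
    · refine absurd ?_ hv
      have := congrArg L.rng (eq_of_mem_cone h1 h2 (by rw [L.deg_ident, L.deg_ident]))
      rwa [L.rng_ident, L.rng_ident] at this
    · rfl
    · rfl
  · ext ξ x
    change bdryOp a (bdryOp b ξ) x = _
    rw [bdryOp_apply, bdryOp_apply, bdryOp_apply]
    by_cases ha : x ∈ cone a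
    · rw [if_pos ha]
      simp only [shiftOut_mem_cone h ha]
      split_ifs with hab
      · rw [shiftOut_comp h hab]
      · rfl
    · rw [if_neg ha, if_neg fun hab => ha (cone_mono (extends_comp a b h) hab)]
  · ext ξ x
    rw [finsum_mem_eq_finite_toFinset_sum _ (hL a b), sum_apply,
      lp.coeFn_sum, Finset.sum_apply]
    exact star_bdryOp_mul_apply hL a b ξ x
  · ext ξ x
    refine gapProd_bdryOp_apply (fun hx => ?_) ξ
    obtain ⟨a, ha, hax⟩ := exists_mem_cone_of_mem_FE hE hx
    refine ⟨a, ?_, hax⟩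
    rw [← Multiset.mem_coe, hl]
    exact ha

/-- The boundary representation, as one of the representations that define `C*(Λ)`. -/
noncomputable def bdryRep (hL : L.FinitelyAligned) : L.CKRep :=
  ⟨Hilb L.Boundary →L[ℂ] Hilb L.Boundary, bdryOp, bdryOp_isCuntzKriegerFamily hL⟩

/-- In the boundary representation, the paths with a given source are linearly independent, and stay
so when multiplied on the right by a path. -/
theorem eq_zero_of_sum_bdryOp {v : L.Vertex} {e : L.Path} (he : L.rng e = v) (y : L.Path →₀ ℂ)
    (hy : ∀ c ∈ y.support, L.src c = v) (h0 : (y.sum fun c r => r • bdryOp c) * bdryOp e = 0) :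
    y = 0 := by
  classical
  by_contra hne
  obtain ⟨c₀, hc₀⟩ := Finsupp.support_nonempty_iff.2 hne
  obtain ⟨z, hz⟩ := exists_mem_cone_ident (L.src e)
  have hez := shiftIn_mem_cone_self hz
  have hv : shiftIn e z ∈ cone (L.ident v) := cone_mono (extends_ident_iff.2 he) hez
  -- Apply the operator to the point mass at z and evaluate at c₀ e z: only the term of c₀ survives,
  -- and it contributes its coefficient.
  have h1 := congrArg (fun T : Hilb L.Boundary →L[ℂ] Hilb L.Boundary =>
    T (lp.single 2 z 1) (shiftIn c₀ (shiftIn e z))) h0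
  simp only [mul_apply_eq_comp, Finsupp.sum, sum_apply,
    lp.coeFn_sum, Finset.sum_apply, smul_apply, lp.coeFn_smul, Pi.smul_apply,
    zero_apply, lp.coeFn_zero, Pi.zero_apply] at h1
  rw [Finset.sum_eq_single c₀ ?_ fun h => absurd hc₀ h] at h1
  · have hv₀ : shiftIn e z ∈ cone (L.ident (L.src c₀)) := by rwa [hy c₀ hc₀]
    rw [bdryOp_apply, if_pos (shiftIn_mem_cone_self hv₀), shiftOut_shiftIn hv₀, bdryOp_apply,
      if_pos hez, shiftOut_shiftIn hz, lp.single_apply_self, smul_eq_mul, mul_one] at h1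
    exact Finsupp.mem_support_iff.1 hc₀ h1
  · intro c hc hcc
    rw [bdryOp_apply, bdryOp_apply]
    by_cases h2 : shiftIn c₀ (shiftIn e z) ∈ cone c
    · by_cases h3 : shiftOut c (shiftIn c₀ (shiftIn e z)) ∈ cone e
      · rw [if_pos h2, if_pos h3, lp.single_apply_ne, smul_zero]
        intro h4
        apply hcc
        have hv₀ : shiftIn e z ∈ cone (L.ident (L.src c₀)) := by rwa [hy c₀ hc₀]
        refine eq_of_mem_cone h2 (shiftIn_mem_cone_self hv₀) ?_
        -- If c also contributed, c₀ e z would equal c e z. Comparing labels in ℤ^k gives d(c) =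
        -- d(c₀), and two initial segments of the same degree coincide.
        have h5 : z.2 + degInt e + degInt c₀ - degInt c - degInt e = z.2 := congrArg Prod.snd h4
        funext i
        have := congrFun h5 i
        simp only [Pi.add_apply, Pi.sub_apply, degInt] at this
        omega
      · rw [if_neg h3, ite_self, smul_zero]
    · rw [if_neg h2, smul_zero]

end HigherRankGraph

namespace HigherRankGraph

variable {k : ℕ} {L : HigherRankGraph.{u} k}

/-! ### Spanning sets -/

namespace IsKumjianPaskFamily

variable {R : Type*} [CommRing R] {A : Type*} [NonUnitalRing A] [Module R A] {S S' : L.Path → A}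

theorem path_mul_mem_span [SMulCommClass R A A] (h : L.IsKumjianPaskFamily S S') (c : L.Path) {x : A}
    (hx : x ∈ Submodule.span R {x | ∃ a b, x = S a * S' b}) :
    S c * x ∈ Submodule.span R {x | ∃ a b, x = S a * S' b} := by
  induction hx using Submodule.span_induction with
  | mem x hx =>
    obtain ⟨a, b, rfl⟩ := hx
    rw [← mul_assoc]
    by_cases hca : L.src c = L.rng a
    · rw [h.kp2_path _ _ hca]
      exact Submodule.subset_span ⟨_, _, rfl⟩
    · rw [h.path_mul_path hca, zero_mul]
      exact zero_mem _
  | zero =>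
    rw [mul_zero]
    exact zero_mem _
  | add x y _ _ hx hy =>
    rw [mul_add]
    exact add_mem hx hy
  | smul r x _ hx =>
    rw [mul_smul_comm]
    exact Submodule.smul_mem _ _ hx

theorem ghost_mul_mem_span [SMulCommClass R A A] (hL : L.FinitelyAligned)
    (h : L.IsKumjianPaskFamily S S') (c : L.Path) {x : A}
    (hx : x ∈ Submodule.span R {x | ∃ a b, x = S a * S' b}) :
    S' c * x ∈ Submodule.span R {x | ∃ a b, x = S a * S' b} := by
  induction hx using Submodule.span_induction with
  | mem x hx =>
    obtain ⟨a, b, rfl⟩ := hx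
    rw [← mul_assoc, h.kp3, finsum_mem_eq_finite_toFinset_sum _ (hL c a), Finset.sum_mul]
    refine Submodule.sum_mem _ fun p _ => ?_
    rw [mul_assoc]
    by_cases hbp : L.src b = L.rng p.2
    · rw [h.kp2_ghost _ _ hbp]
      exact Submodule.subset_span ⟨_, _, rfl⟩
    · rw [h.ghost_mul_ghost hbp, mul_zero]
      exact zero_mem _
  | zero =>
    rw [mul_zero]
    exact zero_mem _
  | add x y _ _ hx hy =>
    rw [mul_add]
    exact add_mem hx hy
  | smul r x _ hx =>
    rw [mul_smul_comm]
    exact Submodule.smul_mem _ _ hx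

theorem path_mem_span (h : L.IsKumjianPaskFamily S S') (a : L.Path) :
    S a ∈ Submodule.span R {x | ∃ a b, x = S a * S' b} :=
  Submodule.subset_span ⟨a, L.ident (L.src a), by rw [h.ghost_ident, h.mul_ident]⟩

theorem ghost_mem_span (h : L.IsKumjianPaskFamily S S') (a : L.Path) :
    S' a ∈ Submodule.span R {x | ∃ a b, x = S a * S' b} :=
  Submodule.subset_span ⟨L.ident (L.src a), a, by rw [h.ident_mul_ghost]⟩

end IsKumjianPaskFamily

/-- Induction on words: the span contains the letters, and left multiplication by a letter preserves
it. -/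
theorem KP.span_eq_top (hL : L.FinitelyAligned) (R : Type w) [CommRing R] :
    Submodule.span R {x | ∃ a b, x = KP.s L R a * KP.sGhost L R b} = ⊤ := by
  have h := KP.isKumjianPaskFamily hL R
  rw [eq_top_iff]
  rintro x -
  obtain ⟨f, rfl⟩ := KP.mkLinear_surjective x
  induction f using MonoidAlgebra.induction_linear with
  | zero =>
    rw [map_zero]
    exact zero_mem _
  | add f g hf hg =>
    rw [map_add]
    exact add_mem hf hg
  | single w r =>
    have hr : (MonoidAlgebra.single w r : L.FreeAlg R) =
        r • (MonoidAlgebra.single w 1 : L.FreeAlg R) := by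
      rw [MonoidAlgebra.smul_single, smul_eq_mul, mul_one]
    rw [hr, map_smul]
    clear hr
    refine Submodule.smul_mem _ _ ?_
    induction w using FreeSemigroup.recOnMul with
    | ih1 x =>
      cases x with
      | path a => exact h.path_mem_span a
      | ghost a => exact h.ghost_mem_span a
    | ih2 x w _ hw =>
      have hm : (MonoidAlgebra.single (FreeSemigroup.of x * w) 1 : L.FreeAlg R) =
          MonoidAlgebra.single (FreeSemigroup.of x) 1 * MonoidAlgebra.single w 1 := by
        simp
      rw [hm, KP.mkLinear_mul]
      cases x with
      | path a => exact h.path_mul_mem_span a hw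
      | ghost a => exact h.ghost_mul_mem_span hL a hw

/-! ### Uniqueness -/

/-- Let `x ≠ 0` in the span of a Kumjian-Pask family. Then some non-zero combination of paths with
source `v`, times some path with range `v`, lies in the right ideal generated by `x`. -/
theorem IsKumjianPaskFamily.exists_combination {R : Type*} [CommRing R] {A : Type*}
    [NonUnitalRing A] [Module R A] [SMulCommClass R A A] [IsScalarTower R A A] {S S' : L.Path → A}
    (hL : L.FinitelyAligned) (h : L.IsKumjianPaskFamily S S') {x : A} (hx : x ≠ 0)
    (hxs : x ∈ Submodule.span R {x | ∃ a b, x = S a * S' b}) :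
    ∃ (v : L.Vertex) (e : L.Path) (y : L.Path →₀ R) (z : A), L.rng e = v ∧
      (∀ c ∈ y.support, L.src c = v) ∧ y ≠ 0 ∧ x * z = (y.sum fun c r => r • S c) * S e := by
  classical
  have hset : {x | ∃ a b, x = S a * S' b} = Set.range fun p : L.Path × L.Path => S p.1 * S' p.2 := by
    ext x
    simp [eq_comm]
  rw [hset, Finsupp.mem_span_range_iff_exists_finsupp] at hxs
  obtain ⟨f, rfl⟩ := hxs
  set x := f.sum fun p r => r • (S p.1 * S' p.2) with hxdef
  obtain ⟨v, hv⟩ : ∃ v, x * S (L.ident v) ≠ 0 := by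
    by_contra! hcon
    apply hx
    -- Finitely many ghosts occur in x, so the sum of the idempotents at their ranges is a right
    -- unit for x.
    have hunit : x * ∑ v ∈ f.support.image fun p => L.rng p.2, S (L.ident v) = x := by
      rw [hxdef, Finsupp.sum, Finset.sum_mul]
      refine Finset.sum_congr rfl fun p hp => ?_
      rw [Finset.mul_sum, Finset.sum_eq_single (L.rng p.2), smul_mul_assoc, mul_assoc,
        h.ghost_mul_ident]
      · intro v _ hv
        rw [← h.ghost_mul_ident, smul_mul_assoc, mul_assoc, mul_assoc, h.kp1_orth _ _ hv.symm,
          mul_zero, mul_zero, smul_zero]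
      · intro hp'
        exact absurd (Finset.mem_image_of_mem _ hp) hp'
    rw [← hunit, Finset.mul_sum]
    exact Finset.sum_eq_zero fun v _ => hcon v
  -- The cut is made along all paths whose ghosts occur in x.
  obtain ⟨l, b, hne, hM⟩ := h.exists_cut hL x (f.support.image Prod.snd).toList hv
  obtain ⟨l', hl', hgap⟩ := h.exists_gapAct_path hL l b
  set g := gapAct S S' l' (S (L.ident (L.src b))) with hg
  -- A term S_p S_{q*} vanishes if q was removed. If instead b = qc, then S_{q*} S_b = S_c, and the
  -- term becomes S_p S_c g, a path with the source of b times g, or zero.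
  have hw : x * gapAct S S' l (S b) ∈
      (Submodule.span R (S '' {c | L.src c = L.src b})).map (LinearMap.mulRight R g) := by
    rw [hxdef, Finsupp.sum, Finset.sum_mul]
    refine Submodule.sum_mem _ fun p hp => ?_
    rw [smul_mul_assoc]
    refine Submodule.smul_mem _ _ ?_
    rcases hM p.2 (by simpa using ⟨p.1, Finsupp.mem_support_iff.1 hp⟩) with hpl | ⟨c, hc, hpc⟩
    · rw [mul_assoc, h.ghost_mul_gapAct_of_mem hL hpl, mul_zero]
      exact zero_mem _
    · have hbc : S' p.2 * S b = S c := by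
        rw [← hpc, ← h.kp2_path _ _ hc, ← mul_assoc, h.ghost_mul_path_self, hc, h.ident_mul]
      rw [hgap, mul_assoc, ← mul_assoc (S' p.2), hbc, ← mul_assoc]
      by_cases hpc' : L.src p.1 = L.rng c
      · rw [h.kp2_path _ _ hpc']
        refine ⟨_, Submodule.subset_span ⟨L.comp p.1 c hpc', ?_, rfl⟩, rfl⟩
        change L.src _ = L.src b
        rw [L.src_comp, ← hpc, L.src_comp]
      · rw [h.path_mul_path hpc', zero_mul]
        exact zero_mem _
  obtain ⟨w, hw, hwx⟩ := hw
  rw [LinearMap.mulRight_apply] at hwx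
  rw [← hwx] at hne
  obtain ⟨e, he, hle⟩ := h.exists_minExt_eq_empty hL hl' (right_ne_zero_of_mul hne)
  obtain ⟨y, hy, rfl⟩ := (Finsupp.mem_span_image_iff_linearCombination R).1 hw
  refine ⟨L.src b, e, y, gapAct S S' l (S b) * S e, he, fun c hc => ?_, ?_, ?_⟩
  · exact (Finsupp.mem_supported R y).1 hy hc
  · rintro rfl
    simp at hne
  -- Since e avoids every path in `l'`, all their range projections kill S_e, so g S_e = S_e.
  · rw [← mul_assoc, ← hwx, mul_assoc, hg, ← gapAct_mul, ← he, h.ident_mul, gapAct_eq_self]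
    · rfl
    · intro a ha
      have hae : L.minExt a e = ∅ := Set.eq_empty_of_forall_notMem fun p hp => by
        have := minExt_swap hp
        rw [hle a ha] at this
        exact this
      rw [mul_assoc, h.kp3, hae]
      simp

theorem IsCuntzKriegerFamily.isKumjianPaskFamily {B : Type*} [NonUnitalCStarAlgebra B]
    {T : L.Path → B} (h : L.IsCuntzKriegerFamily T) :
    L.IsKumjianPaskFamily T fun a => star (T a) where
  ghost_ident v := (h.tck1_proj v).isSelfAdjoint.star_eq
  kp1_idem v := (h.tck1_proj v).isIdempotentElem.eq
  kp1_orth := h.tck1_orth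
  kp2_path := h.tck2
  kp2_ghost a b hab := by rw [← star_mul, h.tck2 a b hab]
  kp3 := h.tck3
  kp4 := h.ck

/-- A homomorphism on the Kumjian-Pask algebra that sends the generators to the boundary
representation is injective. -/
theorem KP.injective_of_bdryOp (hL : L.FinitelyAligned)
    (f : L.KP ℂ →ₙₐ[ℂ] (Hilb L.Boundary →L[ℂ] Hilb L.Boundary))
    (hf : ∀ a, f (KP.s L ℂ a) = bdryOp a) : Function.Injective f := by
  refine (injective_iff_map_eq_zero f).2 fun x hx => ?_
  by_contra hne
  obtain ⟨v, e, y, z, he, hy, hy0, hxz⟩ :=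
    (KP.isKumjianPaskFamily hL ℂ).exists_combination (R := ℂ) hL hne (by
      rw [KP.span_eq_top hL]
      trivial)
  refine hy0 (eq_zero_of_sum_bdryOp he y hy ?_)
  have h0 := congrArg f hxz
  rw [map_mul, hx, zero_mul, map_mul, hf, Finsupp.sum, map_sum] at h0
  rw [h0, Finsupp.sum]
  simp only [map_smul, hf]

end HigherRankGraph

/-! ### The isomorphism onto the dense subalgebra -/

open HigherRankGraph in
theorem mainTheorem10 {k : ℕ} (hk : 0 < k) (L : HigherRankGraph.{u} k) (hL : L.FinitelyAligned) :
    ∃ A : NonUnitalSubalgebra ℂ L.CStar,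
      A.toSubmodule = Submodule.span ℂ {x | ∃ a b : L.Path, x = L.t a * star (L.t b)} ∧
      Dense (A : Set L.CStar) ∧
      ∃ π : L.KP ℂ →ₙₐ[ℂ] A, Function.Bijective π ∧
        (∀ a, (π (HigherRankGraph.KP.s L ℂ a) : L.CStar) = L.t a) ∧
        (∀ b, (π (HigherRankGraph.KP.sGhost L ℂ b) : L.CStar) = star (L.t b)) := by
  have hKP := (t_isCuntzKriegerFamily hL).isKumjianPaskFamily
  obtain ⟨f, hf, -⟩ := KP.existsUnique_hom (R := ℂ) hL hKP
  have hspan : (NonUnitalAlgHom.range f).toSubmodule =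
      Submodule.span ℂ {x | ∃ a b : L.Path, x = L.t a * star (L.t b)} := by
    have h1 : (NonUnitalAlgHom.range f).toSubmodule = (⊤ : Submodule ℂ (L.KP ℂ)).map
        (f : L.KP ℂ →ₗ[ℂ] L.CStar) := by
      ext x
      simp [NonUnitalAlgHom.mem_range]
    rw [h1, ← KP.span_eq_top hL, Submodule.map_span]
    congr 1
    ext x
    constructor
    · rintro ⟨_, ⟨a, b, rfl⟩, rfl⟩
      exact ⟨a, b, by simp [hf]⟩
    · rintro ⟨a, b, rfl⟩
      exact ⟨_, ⟨a, b, rfl⟩, by simp [hf]⟩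
  refine ⟨NonUnitalAlgHom.range f, hspan, ?_, NonUnitalAlgHom.rangeRestrict f, ⟨?_, ?_⟩, fun a => (hf a).1,
    fun a => (hf a).2⟩
  · refine CStar.dense_adjoin.mono fun x hx => ?_
    induction hx using NonUnitalStarAlgebra.adjoin_induction with
    | mem x hx =>
      obtain ⟨a, rfl⟩ := hx
      exact ⟨_, (hf a).1⟩
    | add x y _ _ hx hy => exact add_mem hx hy
    | zero => exact zero_mem _
    | mul x y _ _ hx hy => exact mul_mem hx hy
    | smul r x _ hx => exact SMulMemClass.smul_mem r hx
    | star x _ hx =>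
      -- The range of `f` is only known to be a subalgebra; closure under `star` is seen on the
      -- spanning set, where it exchanges a and b.
      have hstar : ∀ x ∈ Submodule.span ℂ {x | ∃ a b : L.Path, x = L.t a * star (L.t b)},
          star x ∈ Submodule.span ℂ {x | ∃ a b : L.Path, x = L.t a * star (L.t b)} := by
        intro x hx
        induction hx using Submodule.span_induction with
        | mem x hx =>
          obtain ⟨a, b, rfl⟩ := hx
          rw [star_mul, star_star]
          exact Submodule.subset_span ⟨b, a, rfl⟩
        | zero =>
          rw [star_zero]
          exact zero_mem _
        | add x y _ _ hx hy =>
          rw [star_add]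
          exact add_mem hx hy
        | smul r x _ hx =>
          rw [star_smul]
          exact Submodule.smul_mem _ _ hx
      rw [← hspan] at hstar
      exact hstar x hx
  -- The boundary representation is one of the coordinates of `C*(Λ)`, so injectivity after
  -- evaluating there gives injectivity of `f`.
  · have hinj := KP.injective_of_bdryOp hL
      ((CStar.eval (bdryRep hL) : L.CStar →ₙₐ[ℂ] (bdryRep hL).B).comp f)
      fun a => congrArg (CStar.eval (bdryRep hL)) (hf a).1
    exact fun x y hxy => hinj (congrArg (fun z => CStar.eval (bdryRep hL) z.1) hxy)
  · rintro ⟨_, x, rfl⟩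
    exact ⟨x, rfl⟩
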